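/- Let $0<q<1$. Write $(a;q)_k=\prod_{i=0}^{k-1}(1-aq^i)$ and $(a_1,\dots,a_r;q)_k=\prod_{p=1}^r(a_p;q)_k$. For $n\in\mathbb Z_{\ge0}$ define the Askey–Wilson polynomials $$p_n(\cos\theta;a,b,c,d\mid q)=a^{-n}(ab,ac,ad;q)_n\sum_{k=0}^n\frac{(q^{-n},abcdq^{n-1},ae^{i\theta},ae^{-i\theta};q)_k}{(ab,ac,ad,q;q)_k}\,q^k,$$ $$p_n^{(\alpha,\beta)}(x;s,t\mid q)=p_n\bigl(x;q^{1/2}t/s,\;q^{1/2+\alpha}s/t,\;-q^{1/2}/(st),\;-st\,q^{1/2+\beta}\mid q\bigr),$$ the continuous $q$-ultraspherical polynomials $$C_n(\cos\theta;\beta\mid q)=\sum_{k=0}^n\frac{(\beta;q)_k(\beta;q)_{n-k}}{(q;q)_k(q;q)_{n-k}}\,e^{i(n-2k)\theta},$$ and, for integers $0\le n\le N$, the $q$-Hahn polynomials $$Q_n(x;a,b,N;q)=\sum_{k=0}^n\frac{(q^{-n},abq^{n+1},x;q)_k}{(aq,q^{-N},q;q)_k}\,q^k .$$ Let $E_-$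 be the operator acting on trigonometric polynomials $f(e^{i\theta})$ (Laurent polynomials $f(z)$ in $z=e^{i\theta}$) by $(E_-f)(e^{i\theta})=f(q^{-1}e^{i\theta})$. **Proposition 10.4.** Let $l,m$ be integers with $0\le m\le l$. For every $\tau\in\mathbb R$, $$\begin{aligned}&Q_m(q^{-l}E_-;q^{-1},q^{-1},l;q^2)\,p_l^{(0,0)}(\cos\theta;1,q^{\tau/2}\mid q)\\&=\tfrac12(q^{l+1};q)_m\,e^{-im\theta}\Bigl\{(e^{i\theta}q^{(1-\tau)/2},-e^{i\theta}q^{(1+\tau)/2};q)_m\,p_{l-m}^{(m,m)}(\cos\theta;1,q^{\tau/2}\mid q)\\&\qquad+(e^{i\theta}q^{(1+\tau)/2},-e^{i\theta}q^{(1-\tau)/2};q)_m\,p_{l-m}^{(m,m)}(\cos\theta;1,q^{-\tau/2}\mid q)\Bigr\}.\end{aligned}$$ In particular, for $\tau=0$, $$Q_m(q^{-l}E_-;q^{-1},q^{-1},l;q^2)\,C_l(\cos\theta;q\mid q^2)=\frac{(q;q^2)_m}{(q^{2l-2m+2};q^2)_m}\,e^{-im\theta}(qe^{2i\theta};q^2)_m\,C_{l-m}(\cos\theta;q^{1+2m}\mid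 q^2).$$ Both are identities of Laurent polynomials in $z=e^{i\theta}$, valid for all nonzero complex $z$. -/

import Mathlib

open Polynomial

/-- The `q`-shifted factorial `(a;q)_k = ∏_{i<k} (1 - a q^i)`. -/
noncomputable def qShifted (a q : ℂ) (k : ℕ) : ℂ :=
  ∏ i ∈ Finset.range k, (1 - a * q ^ i)

/-- The Askey-Wilson polynomial `p_n(cos θ; a, b, c, d | q)`, as a function of `z = e^{iθ}`:
`a^{-n} (ab,ac,ad;q)_n ₄φ₃(q^{-n}, abcd q^{n-1}, a e^{iθ}, a e^{-iθ}; ab, ac, ad; q, q)`.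
The series terminates after the term `k = n` because of the upper parameter `q^{-n}`. -/
noncomputable def askeyWilson (n : ℕ) (a b c d q z : ℂ) : ℂ :=
  a ^ (-(n : ℤ)) * (qShifted (a * b) q n * qShifted (a * c) q n * qShifted (a * d) q n) *
    ∑ k ∈ Finset.range (n + 1),
      (qShifted (q ^ (-(n : ℤ))) q k * qShifted (a * b * c * d * q ^ ((n : ℤ) - 1)) q k *
          qShifted (a * z) q k * qShifted (a * z⁻¹) q k) /
        (qShifted (a * b) q k * qShifted (a * c) q k * qShifted (a * d) q k * qShifted q q k) *
        q ^ k

/-- The Askey-Wilson `q`-Jacobi polynomial `p_n^{(α,β)}(cos θ; s, t | q)`, i.e. the Askey-Wilson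
polynomial with parameters `q^{1/2} t/s`, `q^{1/2+α} s/t`, `-q^{1/2}/(st)`, `-st q^{1/2+β}`,
as a function of `z = e^{iθ}`. -/
noncomputable def qJacobi (n : ℕ) (α β s t q : ℝ) (z : ℂ) : ℂ :=
  askeyWilson n
    ((q ^ (1 / 2 : ℝ) * t / s : ℝ) : ℂ)
    ((q ^ (1 / 2 + α : ℝ) * s / t : ℝ) : ℂ)
    ((-(q ^ (1 / 2 : ℝ) / (s * t)) : ℝ) : ℂ)
    ((-(s * t * q ^ (1 / 2 + β : ℝ)) : ℝ) : ℂ)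
    (q : ℂ) z

/-- The continuous `q`-ultraspherical polynomial `C_n(cos θ; β | q)`, as a function of
`z = e^{iθ}`: `∑_k (β;q)_k (β;q)_{n-k} / ((q;q)_k (q;q)_{n-k}) e^{i(n-2k)θ}`. -/
noncomputable def qUltraspherical (n : ℕ) (β q z : ℂ) : ℂ :=
  ∑ k ∈ Finset.range (n + 1),
    (qShifted β q k * qShifted β q (n - k)) / (qShifted q q k * qShifted q q (n - k)) *
      z ^ ((n : ℤ) - 2 * (k : ℤ))

/-- The `q`-Hahn polynomial (for `n ≤ N`), as a polynomial in `x`: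
`Q_n(x; a, b, N; q) = ₃φ₂(q^{-n}, a b q^{n+1}, x; a q, q^{-N}; q, q)`.
The factor `(x;q)_k` is the polynomial `∏_{i<k} (1 - q^i X)`, and the series terminates after the
term `k = n`. -/
noncomputable def qHahn (n : ℕ) (a b : ℂ) (N : ℕ) (q : ℂ) : ℂ[X] :=
  ∑ k ∈ Finset.range (n + 1),
    C ((qShifted (q ^ (-(n : ℤ))) q k * qShifted (a * b * q ^ (n + 1)) q k) /
        (qShifted (a * q) q k * qShifted (q ^ (-(N : ℤ))) q k * qShifted q q k) * q ^ k) *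
      ∏ i ∈ Finset.range k, (1 - C (q ^ i) * X)

/-- The `q`-shift operator `(E₋ f)(z) = f(q⁻¹ z)`, as a linear operator on functions of
`z = e^{iθ}`. (The trigonometric polynomials, that is the Laurent polynomials in `z`, are functions
on the nonzero `z`, a set that is stable under `z ↦ q⁻¹ z` for `q ≠ 0`.) -/
noncomputable def qShiftOp (q : ℂ) : Module.End ℂ (ℂ → ℂ) :=
  LinearMap.funLeft ℂ ℂ (fun z : ℂ => q⁻¹ * z)

/-! The `q`-Hahn polynomials `Q_m = Q_m(x; q⁻¹, q⁻¹, l; q²)` satisfy `x Q_m = A_m Q_{m+1} + (1 - A_m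
- B_m) Q_m + B_m Q_{m-1}` with `A_m = hahnUp`, `B_m = hahnDown`. Since `A_0 = B_0` and the
coefficients are invariant under `m ↦ -m`, the case `m = 0` reads `x Q_0 = 2 A_0 Q_1 + (1 - 2 A_0)
Q_0`. As `A_m ≠ 0` for `m < l`, this recurrence determines `Q_m(q^{-l} E₋) F_0`. It therefore
suffices that the claimed right-hand sides `F_m` satisfy the same recurrence with `x` replaced by
`q^{-l} E₋`; this reduction is `aeval_qHahn_apply`.

For the Askey-Wilson identity, two applications of `q`-Saalschütz give an expansion
(`awPoly_eq_sum`) into products of factorials in `z` and in `1/z`. With the parameters at hand, the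
summand belonging to `t = q^{τ/2}` becomes a combination of functions `shiftBasis` that do not
depend on `m`, and `z ↦ z/q` sends each of them (up to a scalar) to its predecessor. For `m ≥ 1`
each of the two summands then satisfies the recurrence on its own, by a rational identity between
coefficients (`jacobiSummand_recurrence`).

The relation at `m = 0` mixes `t` and `t⁻¹`. Multiplication by `(1 - z/(ht))(1 + tz/h)/z`, with `h =
q^{1/2}`, brings all its terms into one basis `reflBasis`: the `t⁻¹` term turns into a multiple of
an Askey-Wilson polynomial with parameters `a, a⁻¹, c, c⁻¹`. The zeros of the multiplier are
recovered by continuity (`jacobiSummand_initial`).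

The ultraspherical identity uses the same reduction; its recurrences follow from contiguous
relations read off the generating function of `C_n` (`qUltraspherical_relations`). -/

section QShifted

/-! ### Elementary properties of `q`-shifted factorials. -/

variable (a b q : ℂ) (m n : ℕ)

@[simp] theorem qShifted_zero : qShifted a q 0 = 1 := by simp [qShifted]

theorem qShifted_succ : qShifted a q (n + 1) = qShifted a q n * (1 - a * q ^ n) := by
  simp [qShifted, Finset.prod_range_succ]

theorem qShifted_add : qShifted a q (m + n) = qShifted a q m * qShifted (a * q ^ m) q n := by
  simp only [qShifted, Finset.prod_range_add]
  congr 1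
  exact Finset.prod_congr rfl fun i _ => by ring

theorem qShifted_succ' : qShifted a q (n + 1) = (1 - a) * qShifted (a * q) q n := by
  rw [add_comm, qShifted_add]; simp [qShifted]

theorem qShifted_mul_neg : qShifted a q n * qShifted (-a) q n = qShifted (a ^ 2) (q ^ 2) n := by
  simp only [qShifted, ← Finset.prod_mul_distrib]
  exact Finset.prod_congr rfl fun i _ => by ring

variable {a b q m n}

theorem qShifted_ne_zero (h : ∀ i < n, a * q ^ i ≠ 1) : qShifted a q n ≠ 0 :=
  Finset.prod_ne_zero_iff.2 fun i hi =>
    sub_ne_zero.2 fun e => h i (Finset.mem_range.1 hi) e.symm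

theorem qShifted_self_ne_zero (hq : ∀ k, q ^ (k + 1) ≠ 1) : qShifted q q n ≠ 0 :=
  qShifted_ne_zero fun i _ => by simpa [pow_succ'] using hq i

/-- `(-1)^n q^{n(n-1)/2}`, the leading coefficient of `(x;q)_n`. -/
noncomputable def qSign (q : ℂ) (n : ℕ) : ℂ := ∏ i ∈ Finset.range n, (-q ^ i)

theorem qSign_succ : qSign q (n + 1) = qSign q n * (-q ^ n) := by
  simp [qSign, Finset.prod_range_succ]

@[simp] theorem qSign_zero : qSign q 0 = 1 := by simp [qSign]

theorem qSign_add : qSign q (m + n) = qSign q m * qSign q n * q ^ (m * n) := by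
  induction n with
  | zero => simp
  | succ n ih => rw [← add_assoc, qSign_succ, ih, qSign_succ]; ring

theorem qSign_sq : qSign q n ^ 2 * q ^ n = q ^ (n ^ 2) := by
  induction n with
  | zero => simp
  | succ n ih =>
    rw [qSign_succ, show (n + 1) ^ 2 = n ^ 2 + 2 * n + 1 by ring, pow_succ _ (n ^ 2 + 2 * n),
      pow_add _ (n ^ 2), ← ih]; ring

theorem qSign_ne_zero (h : q ≠ 0) : qSign q n ≠ 0 :=
  Finset.prod_ne_zero_iff.2 fun _ _ => neg_ne_zero.2 (pow_ne_zero _ h)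

/-- Reversal of the order of the factors of a `q`-shifted factorial. -/
theorem qShifted_reverse {w : ℂ} (hq : q ≠ 0) (hw : w ≠ 0) :
    qShifted (q / (q ^ n * w)) q n * (w ^ n * qSign q n) = qShifted w q n := by
  have key : ∀ i ∈ Finset.range n, 1 - w * q ^ i =
      (1 - q / (q ^ n * w) * q ^ (n - 1 - i)) * (w * (-q ^ i)) := by
    intro i hi
    have hi := Finset.mem_range.1 hi
    obtain ⟨r, rfl⟩ : ∃ r, n = i + r + 1 := ⟨n - 1 - i, by omega⟩
    have : i + r + 1 - 1 - i = r := by omega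
    rw [this]
    have := pow_ne_zero i hq
    have := pow_ne_zero r hq
    field_simp
    ring
  have h2 : qShifted (q / (q ^ n * w)) q n =
      ∏ i ∈ Finset.range n, (1 - q / (q ^ n * w) * q ^ (n - 1 - i)) := by
    rw [qShifted, ← Finset.prod_range_reflect]
  rw [h2, qShifted, Finset.prod_congr rfl key, Finset.prod_mul_distrib, Finset.prod_mul_distrib]
  simp [qSign]

/-- Turns the terminating upper parameter `q^{-N}` into a quotient of factorials. The induction on
`m` keeps `N = m + n` fixed and lowers `n`. -/
theorem qShifted_inv_pow (hq : q ≠ 0) (hq1 : ∀ k, q ^ (k + 1) ≠ 1) :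
    qShifted (q ^ (m + n))⁻¹ q m * q ^ ((m + n) * m) * qShifted q q n =
      qSign q m * qShifted q q (m + n) := by
  induction m generalizing n with
  | zero => simp
  | succ m ih =>
    have := @ih (n + 1)
    have e : m + 1 + n = m + (n + 1) := by ring
    rw [e, qShifted_succ, qSign_succ]
    rw [qShifted_succ q q n] at this
    have hn : 1 - q * q ^ n ≠ 0 := sub_ne_zero.2 fun e => hq1 n (by rw [pow_succ', ← e])
    have h1 : (1 - (q ^ (m + (n + 1)))⁻¹ * q ^ m) = - (q ^ (n + 1))⁻¹ * (1 - q * q ^ n) := by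
      have := pow_ne_zero m hq
      have := pow_ne_zero n hq
      field_simp
      ring
    rw [h1]
    have h3 : q ^ ((m + (n + 1)) * (m + 1)) = q ^ ((m + (n + 1)) * m) * q ^ m * q ^ (n + 1) := by
      ring
    rw [h3]
    have h4 := pow_ne_zero (n + 1) hq
    generalize qShifted (q ^ (m + (n + 1)))⁻¹ q m = u at this ⊢
    field_simp
    linear_combination -this

end QShifted

/-! ### The `q`-Saalschütz summation. -/

section Saalschutz

variable {q : ℂ}

/-- The partial sums of the telescoping recurrence in `n` behind the `q`-Saalschütz formula. -/
theorem qSaalschutz_partial (hq : ∀ k, q ^ (k + 1) ≠ 1) (W X Y : ℂ) (J r : ℕ) :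
    ∑ j ∈ Finset.range (J + 1),
      (qShifted q q (J + r + 1) / (qShifted q q j * qShifted q q (J + r + 1 - j)) *
          (qShifted X q j * qShifted Y q j * qShifted (W * X * Y * q ^ j) q (J + r + 1 - j) *
            qShifted W q (J + r + 1 - j) * W ^ j) -
        (1 - W * X * q ^ (J + r)) * (1 - W * Y * q ^ (J + r)) *
        (qShifted q q (J + r) / (qShifted q q j * qShifted q q (J + r - j)) *
          (qShifted X q j * qShifted Y q j * qShifted (W * X * Y * q ^ j) q (J + r - j) *
            qShifted W q (J + r - j) * W ^ j))) =
      -(qShifted q q (J + r) / (qShifted q q J * qShifted q q r) * (qShifted X q (J + 1) *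
        qShifted Y q (J + 1) * qShifted (W * X * Y * q ^ J) q r * qShifted W q r * W ^ (J + 1) *
        q ^ r)) := by
  have hs : ∀ n, qShifted q q n ≠ 0 := fun n => qShifted_self_ne_zero hq
  have h1 : ∀ n, 1 - q * q ^ n ≠ 0 := fun n => sub_ne_zero.2 fun e => hq n (by rw [pow_succ', ← e])
  induction J generalizing r with
  | zero =>
    have := hs r
    have := h1 r
    simp [qShifted_succ]
    field_simp
    ring
  | succ J ih =>
    rw [Finset.sum_range_succ, show J + 1 + r = J + (r + 1) by ring, ih (r + 1)]
    rw [show J + (r + 1) + 1 - (J + 1) = r + 1 by omega, show J + (r + 1) - (J + 1) = r by omega]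
    have e1 : qShifted (W * X * Y * q ^ J) q (r + 1) =
        (1 - W * X * Y * q ^ J) * qShifted (W * X * Y * q ^ (J + 1)) q r := by
      rw [qShifted_succ', pow_succ, ← mul_assoc]
    rw [e1]
    have := hs r
    have := h1 r
    have := hs J
    have := h1 J
    have := h1 (J + r + 1)
    have := hs (J + (r + 1))
    simp only [qShifted_succ _ _ (J + 1), qShifted_succ _ _ J, qShifted_succ _ _ r,
      qShifted_succ _ _ (J + (r + 1))]
    field_simp
    ring

/-- The `q`-Saalschütz formula, cleared of denominators. -/
theorem qSaalschutz (hq : ∀ k, q ^ (k + 1) ≠ 1) (W X Y : ℂ) (n : ℕ) :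
    ∑ j ∈ Finset.range (n + 1),
      qShifted q q n / (qShifted q q j * qShifted q q (n - j)) *
        (qShifted X q j * qShifted Y q j * qShifted (W * X * Y * q ^ j) q (n - j) *
          qShifted W q (n - j) * W ^ j) =
      qShifted (W * X) q n * qShifted (W * Y) q n := by
  induction n with
  | zero => simp
  | succ n ih =>
    -- At `r = 0` the telescoped right-hand side is minus the term `j = n + 1` of the sum for `n +
    -- 1`, which is the only term missing.
    have := qSaalschutz_partial hq W X Y n 0
    rw [Finset.sum_sub_distrib, ← Finset.mul_sum] at this
    simp only [add_zero] at this
    rw [ih] at this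
    rw [Finset.sum_range_succ, qShifted_succ (W * X), qShifted_succ (W * Y),
      sub_eq_iff_eq_add.1 this]
    have h0 := qShifted_self_ne_zero (n := n) hq
    have h1 := qShifted_self_ne_zero (n := n + 1) hq
    simp
    field_simp
    ring

end Saalschutz

/-! ### Expansion of Askey-Wilson polynomials in products of factorials in `z` and `1/z`. -/

section

attribute [local irreducible] qShifted

/-- The Askey-Wilson polynomial, written without denominators that depend on the parameters
`b`, `c`, `d`. -/
noncomputable def awPoly (n : ℕ) (a b c d q z : ℂ) : ℂ :=
  (a ^ n)⁻¹ * ∑ k ∈ Finset.range (n + 1),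
    qShifted (q ^ n)⁻¹ q k * (qShifted (a * b * c * d * q ^ n / q) q k * qShifted (a * z) q k) *
      qShifted (a / z) q k * (qShifted (a * b * q ^ k) q (n - k) *
        qShifted (a * c * q ^ k) q (n - k) * qShifted (a * d * q ^ k) q (n - k)) /
      qShifted q q k * q ^ k

/-- Each `(ab;q)_n` splits at `k` and its first part cancels the denominator. The cancelled form
stays meaningful at `ab = 1`, which is needed below. -/
theorem askeyWilson_eq_awPoly {n : ℕ} {a b c d q z : ℂ} (hq0 : q ≠ 0)
    (hb : ∀ i, a * b * q ^ i ≠ 1) (hc : ∀ i, a * c * q ^ i ≠ 1) (hd : ∀ i, a * d * q ^ i ≠ 1) :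
    askeyWilson n a b c d q z = awPoly n a b c d q z := by
  unfold askeyWilson awPoly
  rw [mul_assoc, zpow_neg, zpow_natCast, zpow_neg, zpow_natCast, Finset.mul_sum]
  congr 1
  refine Finset.sum_congr rfl fun k hk => ?_
  obtain ⟨r, rfl⟩ := Nat.exists_eq_add_of_le (Nat.lt_succ_iff.1 (Finset.mem_range.1 hk))
  have e : q ^ (((k + r : ℕ) : ℤ) - 1) = q ^ (k + r) / q := by
    rw [zpow_sub_one₀ hq0, zpow_natCast]; rfl
  have hb' := qShifted_ne_zero (n := k) fun i _ => hb i
  have hc' := qShifted_ne_zero (n := k) fun i _ => hc i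
  have hd' := qShifted_ne_zero (n := k) fun i _ => hd i
  rw [e, qShifted_add (a * b), qShifted_add (a * c), qShifted_add (a * d), Nat.add_sub_cancel_left,
    ← mul_div_assoc, ← div_eq_mul_inv a z]
  field_simp

variable {q : ℂ}

theorem qSign_mul_qSign (j i r : ℕ) :
    qSign q (j + i) * q ^ i * qSign q (i + r) = q ^ ((j + i + r) * i) * (qSign q j * qSign q r) := by
  rw [qSign_add, qSign_add]
  have := qSign_sq (q := q) (n := i)
  linear_combination (qSign q j * qSign q r * q ^ (j * i) * q ^ (i * r)) * this

/-- Puts the `k = j + i` term of the double sum in `awPoly_eq_sum` into Saalschütz form in `i`, all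
factors free of `i` being pulled out. The factorial `(ad q^{j+i};q)_{N-i}` is reversed so that its
base no longer depends on `i`. -/
theorem awPoly_summand_eq (hq0 : q ≠ 0) (hq : ∀ k, q ^ (k + 1) ≠ 1) {a b c d z : ℂ} (ha : a ≠ 0)
    (hd : d ≠ 0) (j : ℕ) {i N : ℕ} (hi : i ≤ N) :
    qShifted (q ^ (j + N))⁻¹ q (j + i) *
      (qShifted q q (j + i) / (qShifted q q j * qShifted q q i) *
        (qShifted (c / z) q j * qShifted (q / (q ^ (j + N) * (b * d))) q j *
          qShifted (a * c * q ^ j) q i * qShifted (a * b * d * z * q ^ (j + N) / q) q i *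
          (a * b * d * z * q ^ (j + N) / q) ^ j)) *
      qShifted (a / z) q (j + i) * (qShifted (a * b * q ^ (j + i)) q (N - i) *
        qShifted (a * c * q ^ (j + i)) q (N - i) * qShifted (a * d * q ^ (j + i)) q (N - i)) /
      qShifted q q (j + i) * q ^ (j + i) =
    qSign q j * q ^ j / (q ^ ((j + N) * j) * qSign q N) * (qShifted q q (j + N) /
      (qShifted q q j * qShifted q q N)) * (a * d * q ^ (j + N) / q) ^ N *
      (a * b * d * z * q ^ (j + N) / q) ^ j * qShifted (a * c * q ^ j) q N *
      qShifted (a / z) q j * qShifted (c / z) q j *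
      qShifted (q / (q ^ (j + N) * (b * d))) q j *
      (qShifted q q N / (qShifted q q i * qShifted q q (N - i)) *
        (qShifted (a / z * q ^ j) q i * qShifted (a * b * d * z * q ^ (j + N) / q) q i *
          qShifted (a * b * q ^ j * q ^ i) q (N - i) *
          qShifted (q / (a * d * q ^ (j + N))) q (N - i) *
          (q / (a * d * q ^ (j + N))) ^ i)) := by
  obtain ⟨r, rfl⟩ := Nat.exists_eq_add_of_le hi
  rw [Nat.add_sub_cancel_left, ← add_assoc]
  have hw : q / (a * d * q ^ (j + i + r)) ≠ 0 := by
    have := pow_ne_zero (j + i + r) hq0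
    positivity
  have h1 := qShifted_reverse (n := r) hq0 hw
  have e1 : q / (q ^ r * (q / (a * d * q ^ (j + i + r)))) = a * d * q ^ (j + i) := by
    have := pow_ne_zero r hq0
    field_simp
    ring
  rw [e1] at h1
  have h2 := qShifted_inv_pow (m := j + i) (n := r) hq0 hq
  have hs : ∀ n, qShifted q q n ≠ 0 := fun n => qShifted_self_ne_zero hq
  have he : ∀ n, qSign q n ≠ 0 := fun n => qSign_ne_zero hq0
  have h3 : qShifted (q ^ (j + i + r))⁻¹ q (j + i) = qSign q (j + i) * qShifted q q (j + i + r) /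
      (q ^ ((j + i + r) * (j + i)) * qShifted q q r) := by
    rw [eq_div_iff (mul_ne_zero (pow_ne_zero _ hq0) (hs r)), ← h2]; ring
  have h4 : qSign q (j + i) =
      q ^ ((j + i + r) * i) * (qSign q j * qSign q r) / (q ^ i * qSign q (i + r)) := by
    rw [eq_div_iff (mul_ne_zero (pow_ne_zero _ hq0) (he _)), ← qSign_mul_qSign]; ring
  have e2 : a * d * q ^ (j + i + r) / q = (q / (a * d * q ^ (j + i + r)))⁻¹ := by
    rw [inv_div]
  rw [← h1, h3, h4, qShifted_add (a * c * q ^ j) q i r, qShifted_add (a / z) q j i, e2,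
    show a * b * q ^ j * q ^ i = a * b * q ^ (j + i) by ring,
    show a * c * q ^ j * q ^ i = a * c * q ^ (j + i) by ring, mul_add _ j i, pow_add _ (_ * j),
    pow_add q j i]
  generalize q / (a * d * q ^ (j + i + r)) = w at *
  generalize qShifted (q / (q ^ (j + i + r) * (b * d))) q j = Y
  generalize a * b * d * z * q ^ (j + i + r) / q = W
  generalize qShifted W q i = W'
  generalize qShifted (a / z) q j = A
  generalize qShifted (a / z * q ^ j) q i = A'
  generalize qShifted (c / z) q j = C
  generalize qShifted (a * b * _) q r = B
  generalize qShifted (a * c * _) q r = D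
  generalize qShifted (a * d * _) q r = D'
  generalize qShifted (a * c * q ^ j) q i = D''
  have k1 := hs j
  have k2 := hs i
  have k3 := hs r
  have k4 := hs (i + r)
  have k5 := hs (j + i)
  have k6 := he (i + r)
  have k7 := he j
  have k8 := he r
  have k9 := pow_ne_zero ((j + i + r) * j) hq0
  have k10 := pow_ne_zero ((j + i + r) * i) hq0
  have k11 := pow_ne_zero i hq0
  generalize qShifted q q (j + i) = u at *
  generalize qShifted q q (i + r) = v at *
  generalize qShifted q q (j + i + r) = w' at *
  generalize q ^ ((j + i + r) * i) = p1 at *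
  generalize q ^ ((j + i + r) * j) = p2 at *
  generalize q ^ i = p3 at *
  generalize qSign q (i + r) = p4 at *
  have hww : w⁻¹ ^ (i + r) * w ^ r * w ^ i = 1 := by
    rw [mul_assoc, ← pow_add, add_comm r, ← mul_pow, inv_mul_cancel₀ hw, one_pow]
  have core : p1 * (qSign q j * qSign q r) / (p3 * p4) * w' / (p2 * p1 * qShifted q q r) *
      (u / (qShifted q q j * qShifted q q i)) / u * (q ^ j * p3) =
      qSign q j * q ^ j / (p2 * p4) * (w' / (qShifted q q j * v)) *
        (v / (qShifted q q i * qShifted q q r)) * qSign q r * (w⁻¹ ^ (i + r) * w ^ r * w ^ i) := by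
    rw [hww]
    field_simp
  linear_combination (C * Y * D'' * W' * W ^ j * (A * A') * (B * D * D')) * core

/-- Saalschütz expands `(abcd q^{n-1}, az; q)_k` as a sum over `j ≤ k`; after the two sums are
interchanged, the sum over `k` is again of Saalschütz type. The result is visibly symmetric in `a ↔
c` and in `b ↔ d`. -/
theorem awPoly_eq_sum (hq0 : q ≠ 0) (hq : ∀ k, q ^ (k + 1) ≠ 1) {a b c d z : ℂ} (ha : a ≠ 0)
    (hb : b ≠ 0) (hd : d ≠ 0) (hz : z ≠ 0) (n : ℕ) :
    awPoly n a b c d q z = ∑ j ∈ Finset.range (n + 1),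
      qShifted q q n / (qShifted q q j * qShifted q q (n - j)) *
        (qShifted (a / z) q j * qShifted (c / z) q j * qShifted (b * z) q (n - j) *
          qShifted (d * z) q (n - j) * qShifted (a * c * q ^ j) q (n - j) *
          qShifted (b * d * q ^ (n - j)) q j) * z ^ (2 * (j : ℤ) - n) := by
  have step : ∀ k ∈ Finset.range (n + 1),
      qShifted (q ^ n)⁻¹ q k * (qShifted (a * b * c * d * q ^ n / q) q k * qShifted (a * z) q k) *
        qShifted (a / z) q k * (qShifted (a * b * q ^ k) q (n - k) *
          qShifted (a * c * q ^ k) q (n - k) * qShifted (a * d * q ^ k) q (n - k)) /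
        qShifted q q k * q ^ k =
      ∑ j ∈ Finset.range (k + 1), qShifted (q ^ n)⁻¹ q k *
        (qShifted q q k / (qShifted q q j * qShifted q q (k - j)) *
        (qShifted (c / z) q j * qShifted (q / (q ^ n * (b * d))) q j *
          qShifted (a * c * q ^ j) q (k - j) * qShifted (a * b * d * z * q ^ n / q) q (k - j) *
          (a * b * d * z * q ^ n / q) ^ j)) *
        qShifted (a / z) q k * (qShifted (a * b * q ^ k) q (n - k) *
          qShifted (a * c * q ^ k) q (n - k) * qShifted (a * d * q ^ k) q (n - k)) /
        qShifted q q k * q ^ k := by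
    intro k _
    have h := qSaalschutz hq (a * b * d * z * q ^ n / q) (c / z) (q / (q ^ n * (b * d))) k
    have hqn := pow_ne_zero n hq0
    have e1 : a * b * d * z * q ^ n / q * (c / z) = a * b * c * d * q ^ n / q := by field_simp
    have e2 : a * b * d * z * q ^ n / q * (q / (q ^ n * (b * d))) = a * z := by field_simp
    have e3 : a * b * d * z * q ^ n / q * (c / z) * (q / (q ^ n * (b * d))) = a * c := by
      field_simp
    rw [e1, e2] at h
    rw [e1] at e3
    rw [← h]
    simp only [Finset.mul_sum, Finset.sum_mul, Finset.sum_div, e3]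
  unfold awPoly
  rw [Finset.sum_congr rfl step, Finset.range_eq_Ico]
  simp only [Finset.range_eq_Ico]
  rw [← Finset.sum_Ico_Ico_comm, Finset.mul_sum]
  refine Finset.sum_congr rfl fun j hj => ?_
  obtain ⟨N, rfl⟩ := Nat.exists_eq_add_of_le (Nat.lt_succ_iff.1 (Finset.mem_Ico.1 hj).2)
  rw [Finset.sum_Ico_eq_sum_range, show j + N + 1 - j = N + 1 by omega, Nat.add_sub_cancel_left]
  have e1 : q / (a * d * q ^ (j + N)) * (a / z * q ^ j) *
      (a * b * d * z * q ^ (j + N) / q) = a * b * q ^ j := by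
    have := pow_ne_zero (j + N) hq0
    field_simp
  have inner := qSaalschutz hq (q / (a * d * q ^ (j + N))) (a / z * q ^ j)
    (a * b * d * z * q ^ (j + N) / q) N
  rw [e1] at inner
  simp only [Nat.add_sub_add_left, Nat.add_sub_cancel_left]
  rw [Finset.sum_congr rfl fun i hi => awPoly_summand_eq (b := b) (c := c) (z := z) hq0 hq ha hd j
    (Nat.lt_succ_iff.1 (Finset.mem_range.1 hi)), ← Finset.mul_sum, inner]
  have e2 : q / (a * d * q ^ (j + N)) * (a / z * q ^ j) = q / (q ^ N * (d * z)) := by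
    have := pow_ne_zero (j + N) hq0
    have := pow_ne_zero N hq0
    field_simp
    ring
  have e3 : q / (a * d * q ^ (j + N)) * (a * b * d * z * q ^ (j + N) / q) = b * z := by
    have := pow_ne_zero (j + N) hq0
    field_simp
  have e4 : q / (q ^ j * (b * d * q ^ N)) = q / (q ^ (j + N) * (b * d)) := by
    rw [pow_add]; ring
  -- Reversal turns the two factorials with inverted arguments into `(dz;q)_N` and `(bd q^N;q)_j`.
  rw [e2, e3, ← qShifted_reverse (n := N) hq0 (mul_ne_zero hd hz),
    ← qShifted_reverse (n := j) (w := b * d * q ^ N) hq0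
      (mul_ne_zero (mul_ne_zero hb hd) (pow_ne_zero _ hq0)), e4]
  have e5 : (2 * (j : ℤ) - ((j + N : ℕ) : ℤ)) = (j : ℤ) - N := by push_cast; ring
  rw [e5, zpow_sub₀ hz, zpow_natCast, zpow_natCast]
  have h5 : qSign q N ^ 2 = q ^ (N ^ 2) / q ^ N := by
    rw [eq_div_iff (pow_ne_zero _ hq0), qSign_sq]
  have := qSign_ne_zero (q := q) (n := N) hq0
  have := qSign_ne_zero (q := q) (n := j) hq0
  have hs : ∀ n, qShifted q q n ≠ 0 := fun n => qShifted_self_ne_zero hq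
  have := hs j
  have := hs N
  generalize qShifted (a / z) q j = A
  generalize qShifted (c / z) q j = C
  generalize qShifted (q / (q ^ (j + N) * (b * d))) q j = Y
  generalize qShifted (q / (q ^ N * (d * z))) q N = Z
  generalize qShifted (a * c * q ^ j) q N = D
  simp only [div_pow, mul_pow, ← pow_mul]
  field_simp
  rw [h5]
  field_simp
  ring

end

/-! ### Symmetry in the parameters, and the degenerate case `ab = 1`. -/

section

attribute [local irreducible] qShifted

/-- Read off from the symmetry of `awPoly_eq_sum`. With the evident symmetry of the defining series
in `b, c, d` it gives invariance under all permutations of the parameters. -/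
theorem awPoly_swap_first {q : ℂ} (hq0 : q ≠ 0) (hq : ∀ k, q ^ (k + 1) ≠ 1) {a b c d z : ℂ}
    (ha : a ≠ 0) (hb : b ≠ 0) (hc : c ≠ 0) (hd : d ≠ 0) (hz : z ≠ 0) (n : ℕ) :
    awPoly n a b c d q z = awPoly n c b a d q z := by
  rw [awPoly_eq_sum hq0 hq ha hb hd hz, awPoly_eq_sum hq0 hq hc hb hd hz]
  refine Finset.sum_congr rfl fun j _ => ?_
  rw [mul_comm c a]
  ring

theorem awPoly_swap_right (n : ℕ) (a b c d q z : ℂ) :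
    awPoly n a b c d q z = awPoly n a b d c q z := by
  unfold awPoly
  congr 1
  refine Finset.sum_congr rfl fun j _ => ?_
  rw [mul_right_comm (a * b) d c]
  ring

theorem awPoly_swap_middle (n : ℕ) (a b c d q z : ℂ) :
    awPoly n a b c d q z = awPoly n a c b d q z := by
  unfold awPoly
  congr 1
  refine Finset.sum_congr rfl fun j _ => ?_
  rw [mul_right_comm a c b, mul_comm (qShifted (a * b * q ^ j) q (n - j))]

/-- When `ab = 1` the Askey-Wilson polynomial vanishes at `z = a` and at `z = a⁻¹`. -/
theorem awPoly_succ_inv {q : ℂ} (hq0 : q ≠ 0) (hq : ∀ k, q ^ (k + 1) ≠ 1) {a : ℂ} (ha : a ≠ 0)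
    (c d z : ℂ) (n : ℕ) :
    awPoly (n + 1) a a⁻¹ c d q z =
      -a⁻¹ * (1 - c * d * q ^ n) * (1 - a * z) * (1 - a / z) *
        awPoly n (a * q) (q / a) c d q z := by
  unfold awPoly
  -- The term `k = 0` contains `(ab;q)_{n+1}` with `ab = 1` and vanishes. Shifting `k` by one leaves
  -- the series with parameters `aq, q/a`.
  rw [Finset.sum_range_succ', Nat.sub_zero, pow_zero, qShifted_succ' (a * a⁻¹ * 1),
    mul_inv_cancel₀ ha]
  simp only [mul_one, sub_self, zero_mul, mul_zero, zero_div, add_zero]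
  rw [← mul_assoc, Finset.mul_sum, Finset.mul_sum]
  refine Finset.sum_congr rfl fun k hk => ?_
  obtain ⟨r, rfl⟩ := Nat.exists_eq_add_of_le (Nat.lt_succ_iff.1 (Finset.mem_range.1 hk))
  have h1 : ∀ n, 1 - q * q ^ n ≠ 0 := fun n => sub_ne_zero.2 fun e => hq n (by rw [pow_succ', ← e])
  have hs : ∀ n, qShifted q q n ≠ 0 := fun n => qShifted_self_ne_zero hq
  have e0 : k + r + 1 - (k + 1) = r := by omega
  have e1 : (q ^ (k + r + 1))⁻¹ * q = (q ^ (k + r))⁻¹ := by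
    have := pow_ne_zero (k + r) hq0
    field_simp
    ring
  have e2 : a * z * q = a * q * z := by ring
  have e3 : a / z * q = a * q / z := by ring
  have e4 : a * q * (q / a) = q * q := by field_simp
  have e5 : c * d * q ^ (k + r) * q = q * q * c * d * q ^ (k + r) / q := by field_simp
  have e6 : (1 : ℂ) * c * d * q ^ (k + r + 1) / q = c * d * q ^ (k + r) := by
    field_simp
    ring
  have e7 : qShifted (1 * q ^ (k + 1)) q r * (1 - q * q ^ (k + r)) =
      (1 - q * q ^ k) * qShifted (q * q * q ^ k) q r := by
    have := qShifted_succ (1 * q ^ (k + 1)) q r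
    rw [qShifted_succ'] at this
    rw [show q * q * q ^ k = 1 * q ^ (k + 1) * q by ring]
    linear_combination -this
  have e8 : ∀ x, a * q * x * q ^ k = a * x * q ^ (k + 1) := fun x => by ring
  rw [e0, qShifted_succ' (q ^ (k + r + 1))⁻¹, qShifted_succ' (1 * c * d * q ^ (k + r + 1) / q),
    qShifted_succ' (a * z), qShifted_succ' (a / z), e1, e2, e3, e4, e6, e5, e8, e8,
    Nat.add_sub_cancel_left, qShifted_succ q, mul_pow a q]
  have e9 : qShifted (1 * q ^ (k + 1)) q r =
      (1 - q * q ^ k) * qShifted (q * q * q ^ k) q r / (1 - q * q ^ (k + r)) := by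
    rw [eq_div_iff (h1 _), e7]
  rw [e9]
  have := h1 k
  have := h1 (k + r)
  have := hs k
  have := pow_ne_zero (k + r) hq0
  generalize qShifted (q ^ (k + r))⁻¹ q k = A1
  generalize qShifted (q * q * c * d * q ^ (k + r) / q) q k = A2
  generalize qShifted (a * q * z) q k = A3
  generalize qShifted (a * q / z) q k = A4
  generalize qShifted (q * q * q ^ k) q r = A5
  generalize qShifted (a * c * q ^ (k + 1)) q r = A6
  generalize qShifted (a * d * q ^ (k + 1)) q r = A7
  have core : (a ^ (k + r + 1))⁻¹ * (1 - (q ^ (k + r + 1))⁻¹) *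
      ((1 - q * q ^ k) / (1 - q * q ^ (k + r))) / (qShifted q q k * (1 - q * q ^ k)) *
        q ^ (k + 1) = -a⁻¹ * (a ^ (k + r) * q ^ (k + r))⁻¹ / qShifted q q k * q ^ k := by
    rw [pow_succ' q (k + r), pow_succ q k, pow_succ a]
    have := h1 (k + r)
    have := h1 k
    generalize q ^ (k + r) = x at *
    field_simp
    ring
  linear_combination ((1 - c * d * q ^ (k + r)) * (1 - a * z) * (1 - a / z) * (A1 * A2 * A3 * A4) *
    (A5 * A6 * A7)) * core

/-- `awPoly_succ_inv` applied to the pair `a, a⁻¹`, then, after a permutation of the parameters, to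
`c, c⁻¹`. -/
theorem awPoly_add_two_inv {q : ℂ} (hq0 : q ≠ 0) (hq : ∀ k, q ^ (k + 1) ≠ 1) {a c z : ℂ}
    (ha : a ≠ 0) (hc : c ≠ 0) (hz : z ≠ 0) (n : ℕ) :
    awPoly (n + 2) a a⁻¹ c c⁻¹ q z =
      (a * c)⁻¹ * (1 - q ^ (n + 1)) * (1 - q ^ (n + 2)) * ((1 - a * z) * (1 - a / z) *
        ((1 - c * z) * (1 - c / z))) * awPoly n (q / a) (a * q) (q / c) (c * q) q z := by
  have haq : a * q ≠ 0 := mul_ne_zero ha hq0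
  have hcq : c * q ≠ 0 := mul_ne_zero hc hq0
  have haq' : q / a ≠ 0 := div_ne_zero hq0 ha
  have hcq' : q / c ≠ 0 := div_ne_zero hq0 hc
  rw [awPoly_succ_inv hq0 hq ha, awPoly_swap_first hq0 hq haq haq' hc (inv_ne_zero hc) hz,
    awPoly_swap_right, awPoly_swap_middle, awPoly_succ_inv hq0 hq hc,
    awPoly_swap_first hq0 hq hcq hcq' haq' haq hz, awPoly_swap_right _ (q / a) (q / c),
    awPoly_swap_middle _ (q / a) (q / c)]
  have e1 : a * q * (q / a) * q ^ n = q ^ (n + 2) := by field_simp; ring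
  rw [mul_inv_cancel₀ hc, mul_comm (q / a) (a * q), e1]
  field_simp

/-! ### A basis common to all `m`. -/

section Basis

variable {q h t z : ℂ}

/-- The functions in which the two-parameter family of the theorem has explicit coefficients. -/
noncomputable def shiftBasis (l : ℕ) (h t q : ℂ) (j : ℕ) (z : ℂ) : ℂ :=
  qShifted (z * (h / t)) q j * qShifted (-(z * (h * t))) q j *
    (qShifted (h * t / z) q (l - j) * qShifted (-(h / t) / z) q (l - j)) *
    z ^ ((l : ℤ) - 2 * j)

/-- The product is `(q;q)_j / (q;q)_{j-m}` for `j ≥ m` and `0` for `j < m`, so that the expansions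
for all `m` run over the same range `j ≤ l`. -/
noncomputable def shiftCoeff (l : ℕ) (q : ℂ) (m j : ℕ) : ℂ :=
  (∏ i ∈ Finset.range m, (1 - q ^ j / q ^ i)) /
    (qShifted q q j * qShifted (-q) q (j + m) * qShifted (q ^ 2) (q ^ 2) (l - j))

/-- One of the two summands on the right-hand side of the theorem, as a function of `z`. -/
noncomputable def jacobiSummand (l m : ℕ) (h t q z : ℂ) : ℂ :=
  qShifted (q ^ (l + 1)) q m * (z ^ m)⁻¹ *
    (qShifted (z * (h / t)) q m * qShifted (-(z * (h * t))) q m *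
      awPoly (l - m) (h * t) (h * q ^ m / t) (-(h / t)) (-(h * t * q ^ m)) q z)

theorem neg_pow_ne_one (hq : ∀ k, q ^ (k + 1) ≠ 1) (k : ℕ) : 1 + q ^ k ≠ 0 := by
  intro e
  have e1 : q ^ k = -1 := by linear_combination e
  rcases k with _ | k
  · norm_num at e1
  · refine hq (2 * k + 1) ?_
    rw [show 2 * k + 1 + 1 = (k + 1) * 2 by ring, pow_mul, e1]; norm_num

theorem qShifted_neg_ne_zero (hq : ∀ k, q ^ (k + 1) ≠ 1) (n : ℕ) : qShifted (-q) q n ≠ 0 :=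
  qShifted_ne_zero fun i _ e => neg_pow_ne_one hq (i + 1) (by rw [pow_succ']; linear_combination -e)

theorem qShifted_sq_ne_zero (hq : ∀ k, q ^ (k + 1) ≠ 1) (n : ℕ) :
    qShifted (q ^ 2) (q ^ 2) n ≠ 0 := by
  rw [← qShifted_mul_neg]
  exact mul_ne_zero (qShifted_self_ne_zero hq) (qShifted_neg_ne_zero hq n)

theorem prod_one_sub_pow_div (hq0 : q ≠ 0) (m k : ℕ) :
    (∏ i ∈ Finset.range m, (1 - q ^ (m + k) / q ^ i)) * qShifted q q k = qShifted q q (m + k) := by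
  induction m generalizing k with
  | zero => simp
  | succ m ih =>
    rw [Finset.prod_range_succ, show m + 1 + k = m + (k + 1) by ring, ← ih (k + 1), qShifted_succ]
    have : q ^ (m + (k + 1)) / q ^ m = q * q ^ k := by
      have := pow_ne_zero m hq0
      field_simp
      ring
    rw [this]; ring

theorem shiftCoeff_of_lt (hq0 : q ≠ 0) (l : ℕ) {m j : ℕ} (hj : j < m) : shiftCoeff l q m j = 0 := by
  have : ∏ i ∈ Finset.range m, (1 - q ^ j / q ^ i) = 0 :=
    Finset.prod_eq_zero (Finset.mem_range.2 hj) (by rw [div_self (pow_ne_zero _ hq0), sub_self])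
  rw [shiftCoeff, this, zero_div]

/-- The prefactors `(zh/t, -zht; q)_m` fit exactly in front of the factorials `(h q^m z/t, -h t q^m
z; q)_k` from `awPoly_eq_sum`, giving factorials of length `j = m + k` whose bases do not involve
`m`. -/
theorem jacobiSummand_eq_sum (hq0 : q ≠ 0) (hq : ∀ k, q ^ (k + 1) ≠ 1) (hh : h ^ 2 = q)
    (ht : t ≠ 0) (hz : z ≠ 0) {l m : ℕ} (hm : m ≤ l) :
    jacobiSummand l m h t q z =
      qShifted (q ^ 2) (q ^ 2) (l - m) * qShifted (q ^ 2) (q ^ 2) (l + m) / qShifted q q l *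
        ∑ j ∈ Finset.range (l + 1), shiftCoeff l q m j * shiftBasis l h t q j z := by
  obtain ⟨n, rfl⟩ := Nat.exists_eq_add_of_le hm
  have hh0 : h ≠ 0 := by rintro rfl; exact hq0 (by rw [← hh]; ring)
  have hqm := pow_ne_zero m hq0
  rw [Nat.add_sub_cancel_left, add_assoc m n 1, Finset.sum_range_add,
    Finset.sum_eq_zero fun j hj => by
      rw [shiftCoeff_of_lt hq0 _ (Finset.mem_range.1 hj), zero_mul], zero_add, jacobiSummand,
    Nat.add_sub_cancel_left, awPoly_eq_sum hq0 hq (mul_ne_zero hh0 ht) (by positivity)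
      (by simp; exact ⟨⟨hh0, ht⟩, fun e => absurd e hq0⟩) hz, ← Finset.sum_range_reflect,
      Finset.mul_sum, Finset.mul_sum, Finset.mul_sum]
  refine Finset.sum_congr rfl fun k hk => ?_
  obtain ⟨r, rfl⟩ := Nat.exists_eq_add_of_le (Nat.lt_succ_iff.1 (Finset.mem_range.1 hk))
  have hs : ∀ n, qShifted q q n ≠ 0 := fun n => qShifted_self_ne_zero hq
  have hn : ∀ n, qShifted (-q) q n ≠ 0 := fun n => qShifted_neg_ne_zero hq n
  rw [show k + r + 1 - 1 - k = r by omega, show k + r - r = k by omega, shiftCoeff, shiftBasis,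
    show m + (k + r) - (m + k) = r by omega]
  have e1 := prod_one_sub_pow_div hq0 m k
  rw [← eq_div_iff (hs k)] at e1
  have e2 : h * t * -(h / t) = -q := by rw [← hh]; field_simp
  have e3 : h * q ^ m / t * -(h * t * q ^ m) * q ^ k = -q * q ^ (m + k + m) := by
    rw [← hh]; field_simp; ring
  have e4 := qShifted_add (-q) q r k
  have e5 := qShifted_add (-q) q (m + k + m) r
  have e6 := qShifted_add q q (m + (k + r)) m
  rw [← pow_succ'] at e6
  have e7 := qShifted_add (z * (h / t)) q m k
  have e8 := qShifted_add (-(z * (h * t))) q m k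
  rw [show z * (h / t) * q ^ m = h * q ^ m / t * z by ring] at e7
  rw [show -(z * (h * t)) * q ^ m = -(h * t * q ^ m) * z by ring] at e8
  have e9 : z ^ (((m + (k + r) : ℕ) : ℤ) - 2 * ((m + k : ℕ) : ℤ)) =
      (z ^ m)⁻¹ * z ^ (2 * (r : ℤ) - ((k + r : ℕ) : ℤ)) := by
    rw [← zpow_natCast z m, ← zpow_neg, ← zpow_add₀ hz]
    congr 1
    push_cast
    ring
  rw [e1, e2, e3, ← qShifted_mul_neg, ← qShifted_mul_neg, ← qShifted_mul_neg, e6, e7, e8, e9,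
    show m + (k + r) + m = m + k + m + r by ring, e5, add_comm k r, e4, pow_succ']
  have := hs (m + (r + k))
  have := hs (m + k)
  have := hs k
  have := hs r
  have := hn r
  have := hn (m + k + m)
  generalize z ^ (2 * (r : ℤ) - ((r + k : ℕ) : ℤ)) = zz
  generalize qShifted (z * (h / t)) q m = A1
  generalize qShifted (-(z * (h * t))) q m = A2
  generalize qShifted (h * t / z) q r = A3
  generalize qShifted (-(h / t) / z) q r = A4
  generalize qShifted (h * q ^ m / t * z) q k = A5
  generalize qShifted (-(h * t * q ^ m) * z) q k = A6
  generalize qShifted (-q * q ^ r) q k = A7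
  generalize qShifted (-q * q ^ (m + k + m)) q r = A8
  have core : qShifted q q (r + k) / (qShifted q q r * qShifted q q k) =
      qShifted q q (r + k) * qShifted (-q) q r *
        (qShifted q q (m + (r + k)) * qShifted (-q) q (m + k + m)) / qShifted q q (m + (r + k)) *
      (qShifted q q (m + k) / qShifted q q k / (qShifted q q (m + k) *
        qShifted (-q) q (m + k + m) * (qShifted q q r * qShifted (-q) q r))) := by
    field_simp
  linear_combination (qShifted (q * q ^ (m + (r + k))) q m * (z ^ m)⁻¹ * zz * (A1 * A2 * A3 * A4) *
    (A5 * A6 * A7 * A8)) * core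

end Basis

end

/-! ### The recurrence in `m` away from `m = 0`. -/

section

attribute [local irreducible] qShifted

/-- The coefficients of the three-term recurrence of the `q`-Hahn polynomials with
`a = b = q⁻¹` in base `q²`. -/
noncomputable def hahnUp (l : ℕ) (q : ℂ) (m : ℕ) : ℂ :=
  (1 - q ^ (2 * m) / q ^ (2 * l)) / ((1 + q ^ (2 * m)) * (1 + q ^ (2 * m + 1)))

noncomputable def hahnDown (l : ℕ) (q : ℂ) (m : ℕ) : ℂ :=
  -(q ^ (2 * m) / q ^ (2 * l)) * (1 - q ^ (2 * m) * q ^ (2 * l)) /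
    ((q + q ^ (2 * m)) * (1 + q ^ (2 * m)))

variable {q h t z : ℂ}

/-- The shift adds a new first factor to each factorial in `z` and removes the first one from each
factorial in `1/z`. Because `h² = q`, the new factors are `1 - z/(ht)` and `1 + tz/h`, monomial
multiples of the removed `1 - ht/z` and `1 + h/(tz)`. -/
theorem shiftBasis_succ_shift (hq0 : q ≠ 0) (hh : h ^ 2 = q) (ht : t ≠ 0) (hz : z ≠ 0) {l j : ℕ}
    (hj : j < l) :
    shiftBasis l h t q (j + 1) (q⁻¹ * z) = -(q ^ (2 * j + 1) / q ^ l) * shiftBasis l h t q j z := by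
  obtain ⟨r, rfl⟩ := Nat.exists_eq_add_of_lt hj
  have hh0 : h ≠ 0 := by rintro rfl; exact hq0 (by rw [← hh]; ring)
  unfold shiftBasis
  rw [show j + r + 1 - (j + 1) = r by omega, show j + r + 1 - j = r + 1 by omega,
    qShifted_succ' (q⁻¹ * z * (h / t)), qShifted_succ' (-(q⁻¹ * z * (h * t))),
    qShifted_succ' (h * t / z), qShifted_succ' (-(h / t) / z),
    show q⁻¹ * z * (h / t) * q = z * (h / t) by field_simp,
    show -(q⁻¹ * z * (h * t)) * q = -(z * (h * t)) by field_simp,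
    show h * t / (q⁻¹ * z) = h * t / z * q by field_simp,
    show -(h / t) / (q⁻¹ * z) = -(h / t) / z * q by field_simp]
  have e1 : (((j + r + 1 : ℕ) : ℤ) - 2 * ((j + 1 : ℕ) : ℤ)) =
      (((j + r + 1 : ℕ) : ℤ) - 2 * (j : ℤ)) - (2 : ℕ) := by push_cast; ring
  have e2 : (((j + r + 1 : ℕ) : ℤ) - 2 * (j : ℤ)) - (2 : ℕ) =
      ((j + r + 1 : ℕ) : ℤ) - ((2 * j + 2 : ℕ) : ℤ) := by push_cast; ring
  rw [e1, mul_zpow, zpow_sub₀ hz, inv_zpow, e2, zpow_sub₀ hq0]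
  simp only [zpow_natCast]
  generalize z ^ (((j + r + 1 : ℕ) : ℤ) - 2 * (j : ℤ)) = zz
  have core : (1 - q⁻¹ * z * (h / t)) * (1 - -(q⁻¹ * z * (h * t))) *
      (q ^ (j + r + 1) / q ^ (2 * j + 2))⁻¹ / z ^ 2 = -(q ^ (2 * j + 1) / q ^ (j + r + 1)) *
        ((1 - h * t / z) * (1 - -(h / t) / z)) := by
    rw [pow_succ _ (2 * j + 1)]
    have h1 := pow_ne_zero (2 * j + 1) hq0
    have h2 := pow_ne_zero (j + r + 1) hq0
    generalize q ^ (2 * j + 1) = x at *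
    generalize q ^ (j + r + 1) = y at *
    rw [← hh]
    field_simp
    ring
  linear_combination (zz * (qShifted (z * (h / t)) q j * qShifted (-(z * (h * t))) q j *
    qShifted (h * t / z * q) q r * qShifted (-(h / t) / z * q) q r)) * core

theorem one_sub_pow_ne_zero (hq : ∀ k, q ^ (k + 1) ≠ 1) (n : ℕ) : 1 - q ^ (n + 1) ≠ 0 :=
  sub_ne_zero.2 fun e => hq n e.symm

/-- The coefficient of `shiftBasis` at `j` in the recurrence, with `l = n + ν + 2` and `r = l - j`.
The right-hand side is what the shift carries down from index `j + 1`. -/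
theorem shiftCoeff_recurrence (hq0 : q ≠ 0) (hq : ∀ k, q ^ (k + 1) ≠ 1) (n ν j r : ℕ)
    (hl : j + r = n + ν + 2) :
    hahnUp (n + ν + 2) q (n + 1) * (qShifted (q ^ 2) (q ^ 2) ν *
        qShifted (q ^ 2) (q ^ 2) (n + ν + 2 + (n + 2)) * shiftCoeff (n + ν + 2) q (n + 2) j) +
      (1 - hahnUp (n + ν + 2) q (n + 1) - hahnDown (n + ν + 2) q (n + 1)) *
        (qShifted (q ^ 2) (q ^ 2) (ν + 1) * qShifted (q ^ 2) (q ^ 2) (n + ν + 2 + (n + 1)) *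
          shiftCoeff (n + ν + 2) q (n + 1) j) +
      hahnDown (n + ν + 2) q (n + 1) * (qShifted (q ^ 2) (q ^ 2) (ν + 2) *
        qShifted (q ^ 2) (q ^ 2) (n + ν + 2 + n) * shiftCoeff (n + ν + 2) q n j) =
    -(q ^ (2 * j + 1) / q ^ (2 * (n + ν + 2))) * (1 - q ^ (2 * r)) *
      (qShifted (q ^ 2) (q ^ 2) (ν + 1) * qShifted (q ^ 2) (q ^ 2) (n + ν + 2 + (n + 1))) *
      (∏ i ∈ Finset.range n, (1 - q ^ j / q ^ i)) /
        (qShifted q q j * qShifted (-q) q (j + n + 2) * qShifted (q ^ 2) (q ^ 2) r) := by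
  unfold shiftCoeff hahnUp hahnDown
  rw [Finset.prod_range_succ, Finset.prod_range_succ, show n + ν + 2 - j = r by omega,
    ← add_assoc j n 2, ← add_assoc j n 1, qShifted_succ _ _ (j + n + 1), qShifted_succ _ _ (j + n),
    ← add_assoc _ n 2, ← add_assoc _ n 1, qShifted_succ _ _ (n + ν + 2 + n + 1),
    qShifted_succ _ _ (n + ν + 2 + n), qShifted_succ _ _ (ν + 1), qShifted_succ _ _ ν]
  have h1 := neg_pow_ne_one hq (2 * (n + 1))
  have h2 := neg_pow_ne_one hq (2 * (n + 1) + 1)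
  have h3 : q + q ^ (2 * (n + 1)) ≠ 0 := by
    have := mul_ne_zero hq0 (neg_pow_ne_one hq (2 * n + 1))
    intro e; apply this; rw [← e]; ring
  have h4 := neg_pow_ne_one hq (j + n + 1)
  have h5 := neg_pow_ne_one hq (j + n + 2)
  have h6 := qShifted_self_ne_zero (n := j) hq
  have h7 := qShifted_neg_ne_zero hq (j + n)
  have h8 := qShifted_sq_ne_zero hq r
  generalize qShifted q q j = A1 at *
  generalize qShifted (-q) q (j + n) = A2 at *
  generalize qShifted (q ^ 2) (q ^ 2) r = A3 at *
  generalize qShifted (q ^ 2) (q ^ 2) ν = A4 at *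
  generalize qShifted (q ^ 2) (q ^ 2) (n + ν + 2 + n) = A5 at *
  generalize (∏ i ∈ Finset.range n, (1 - q ^ j / q ^ i)) = P at *
  have x1 := pow_ne_zero n hq0
  have x2 := pow_ne_zero ν hq0
  have e1 : q ^ (2 * r) = q ^ (2 * (n + ν + 2)) / q ^ (2 * j) := by
    rw [eq_div_iff (pow_ne_zero _ hq0), ← pow_add]; congr 1; omega
  have x3 := pow_ne_zero j hq0
  rw [e1]
  have f1 : 1 - -q * q ^ (j + n) = 1 + q * (q ^ j * q ^ n) := by ring
  have f2 : 1 - -q * q ^ (j + n + 1) = 1 + q * (q * (q ^ j * q ^ n)) := by ring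
  rw [f1, f2]
  simp only [show q ^ (j + n + 1) = q * (q ^ j * q ^ n) by ring,
    show q ^ (j + n + 2) = q * (q * (q ^ j * q ^ n)) by ring,
    show q ^ (2 * (n + 1)) = q ^ 2 * (q ^ n) ^ 2 by ring,
    show q ^ (2 * (n + 1) + 1) = q ^ 3 * (q ^ n) ^ 2 by ring,
    show q ^ (2 * (n + ν + 2)) = q ^ 4 * (q ^ n) ^ 2 * (q ^ ν) ^ 2 by ring,
    show q ^ (2 * j) = (q ^ j) ^ 2 by ring,
    show q ^ (2 * j + 1) = q * (q ^ j) ^ 2 by ring,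
    show (q ^ 2) ^ (ν + 1) = q ^ 2 * (q ^ ν) ^ 2 by ring,
    show (q ^ 2) ^ ν = (q ^ ν) ^ 2 by ring,
    show (q ^ 2) ^ (n + ν + 2 + n) = q ^ 4 * (q ^ n) ^ 4 * (q ^ ν) ^ 2 by ring,
    show (q ^ 2) ^ (n + ν + 2 + n + 1) = q ^ 6 * (q ^ n) ^ 4 * (q ^ ν) ^ 2 by ring,
    show q ^ (n + 1) = q * q ^ n by ring] at *
  have h9 : 1 + q * (q ^ n) ^ 2 ≠ 0 := by
    have := neg_pow_ne_one hq (2 * n + 1)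
    intro e; apply this; rw [← e]; ring
  generalize q ^ n = x at *
  generalize q ^ ν = y at *
  generalize q ^ j = u at *
  -- With the common factors removed, a rational identity in `x = q^n`, `y = q^ν`, `u = q^j`
  -- remains.
  have core : (1 - q ^ 2 * x ^ 2 / (q ^ 4 * x ^ 2 * y ^ 2)) / ((1 + q ^ 2 * x ^ 2) * (1 + q ^ 3 * x ^ 2)) *
        ((1 - q ^ 2 * (q ^ 4 * x ^ 4 * y ^ 2)) * (1 - q ^ 2 * (q ^ 6 * x ^ 4 * y ^ 2)) *
          ((1 - u / x) * (1 - u / (q * x)))) +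
      (1 - (1 - q ^ 2 * x ^ 2 / (q ^ 4 * x ^ 2 * y ^ 2)) / ((1 + q ^ 2 * x ^ 2) * (1 + q ^ 3 * x ^ 2))
        - -(q ^ 2 * x ^ 2 / (q ^ 4 * x ^ 2 * y ^ 2)) * (1 - q ^ 2 * x ^ 2 * (q ^ 4 * x ^ 2 * y ^ 2)) /
          ((q + q ^ 2 * x ^ 2) * (1 + q ^ 2 * x ^ 2))) *
        ((1 - q ^ 2 * y ^ 2) * (1 - q ^ 2 * (q ^ 4 * x ^ 4 * y ^ 2)) * (1 - u / x)) *
        (1 + q * (q * (u * x))) +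
      -(q ^ 2 * x ^ 2 / (q ^ 4 * x ^ 2 * y ^ 2)) * (1 - q ^ 2 * x ^ 2 * (q ^ 4 * x ^ 2 * y ^ 2)) /
          ((q + q ^ 2 * x ^ 2) * (1 + q ^ 2 * x ^ 2)) *
        ((1 - q ^ 2 * y ^ 2) * (1 - q ^ 2 * (q ^ 2 * y ^ 2))) *
        ((1 + q * (u * x)) * (1 + q * (q * (u * x)))) =
      -(q * u ^ 2 / (q ^ 4 * x ^ 2 * y ^ 2)) * (1 - q ^ 4 * x ^ 2 * y ^ 2 / u ^ 2) *
        ((1 - q ^ 2 * y ^ 2) * (1 - q ^ 2 * (q ^ 4 * x ^ 4 * y ^ 2))) := by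
    field_simp
    ring
  have hk : ∀ E F X : ℂ, E ≠ 0 → F ≠ 0 →
      X / (A1 * A2 * A3) = X * (E * F) * (A1 * A2 * A3 * (E * F))⁻¹ ∧
      X / (A1 * (A2 * E) * A3) = X * F * (A1 * A2 * A3 * (E * F))⁻¹ ∧
      X / (A1 * (A2 * E * F) * A3) = X * (A1 * A2 * A3 * (E * F))⁻¹ := fun E F X hE hF => by
    refine ⟨?_, ?_, ?_⟩ <;> field_simp
  rw [(hk _ _ _ h4 h5).1, (hk _ _ _ h4 h5).2.1, (hk _ _ _ h4 h5).2.2, (hk _ _ _ h4 h5).2.2]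
  linear_combination (A4 * A5 * P *
    (A1 * A2 * A3 * ((1 + q * (u * x)) * (1 + q * (q * (u * x)))))⁻¹) * core

theorem jacobiSummand_recurrence (hq0 : q ≠ 0) (hq : ∀ k, q ^ (k + 1) ≠ 1) (hh : h ^ 2 = q)
    (ht : t ≠ 0) (hz : z ≠ 0) {l n : ℕ} (hn : n + 2 ≤ l) :
    (q ^ l)⁻¹ * jacobiSummand l (n + 1) h t q (q⁻¹ * z) =
      hahnUp l q (n + 1) * jacobiSummand l (n + 2) h t q z +
        (1 - hahnUp l q (n + 1) - hahnDown l q (n + 1)) * jacobiSummand l (n + 1) h t q z +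
        hahnDown l q (n + 1) * jacobiSummand l n h t q z := by
  obtain ⟨ν, rfl⟩ : ∃ ν, l = n + ν + 2 := ⟨l - (n + 2), by omega⟩
  have hz' : q⁻¹ * z ≠ 0 := mul_ne_zero (inv_ne_zero hq0) hz
  rw [jacobiSummand_eq_sum hq0 hq hh ht hz' (by omega), jacobiSummand_eq_sum hq0 hq hh ht hz hn,
    jacobiSummand_eq_sum hq0 hq hh ht hz (show n + 1 ≤ n + ν + 2 by omega),
    jacobiSummand_eq_sum hq0 hq hh ht hz (show n ≤ n + ν + 2 by omega),
    show n + ν + 2 - (n + 1) = ν + 1 by omega, show n + ν + 2 - (n + 2) = ν by omega,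
    show n + ν + 2 - n = ν + 2 by omega, Finset.sum_range_succ',
    shiftCoeff_of_lt hq0 _ (Nat.succ_pos n), zero_mul, add_zero]
  simp only [Finset.mul_sum]
  rw [← Finset.sum_add_distrib, ← Finset.sum_add_distrib,
    Finset.sum_range_succ _ (n + ν + 2)]
  have key : ∀ j r, j + r = n + ν + 2 → _ := fun j r hj =>
    shiftCoeff_recurrence hq0 hq n ν j r hj
  -- The shifted side contributes nothing at the top index `j = l`; there the coefficient identity
  -- has `r = 0` and its right-hand side contains `1 - q^0 = 0`.
  have last := key (n + ν + 2) 0 (by omega)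
  simp only [mul_zero, pow_zero, sub_self, zero_mul, zero_div] at last
  have e0 : ∀ B, hahnUp (n + ν + 2) q (n + 1) * (qShifted (q ^ 2) (q ^ 2) ν *
      qShifted (q ^ 2) (q ^ 2) (n + ν + 2 + (n + 2)) / qShifted q q (n + ν + 2) *
        (shiftCoeff (n + ν + 2) q (n + 2) (n + ν + 2) * B)) +
      (1 - hahnUp (n + ν + 2) q (n + 1) - hahnDown (n + ν + 2) q (n + 1)) *
      (qShifted (q ^ 2) (q ^ 2) (ν + 1) * qShifted (q ^ 2) (q ^ 2) (n + ν + 2 + (n + 1)) /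
        qShifted q q (n + ν + 2) * (shiftCoeff (n + ν + 2) q (n + 1) (n + ν + 2) * B)) +
      hahnDown (n + ν + 2) q (n + 1) * (qShifted (q ^ 2) (q ^ 2) (ν + 2) *
        qShifted (q ^ 2) (q ^ 2) (n + ν + 2 + n) / qShifted q q (n + ν + 2) *
        (shiftCoeff (n + ν + 2) q n (n + ν + 2) * B)) = 0 := fun B => by
    linear_combination (B / qShifted q q (n + ν + 2)) * last
  rw [e0, add_zero]
  refine Finset.sum_congr rfl fun j hj => ?_
  obtain ⟨r, hr⟩ := Nat.exists_eq_add_of_lt (Finset.mem_range.1 hj)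
  have hjr := key j (r + 1) (by omega)
  rw [shiftBasis_succ_shift hq0 hh ht hz (Finset.mem_range.1 hj)]
  have e1 : shiftCoeff (n + ν + 2) q (n + 1) (j + 1) =
      (1 - q ^ (2 * (r + 1))) * (∏ i ∈ Finset.range n, (1 - q ^ j / q ^ i)) /
        (qShifted q q j * qShifted (-q) q (j + n + 2) * qShifted (q ^ 2) (q ^ 2) (r + 1)) := by
    have h1 := one_sub_pow_ne_zero hq (2 * r + 1)
    have h2 := one_sub_pow_ne_zero hq j
    have h3 := qShifted_self_ne_zero (n := j) hq
    have h4 := qShifted_neg_ne_zero hq (j + n + 2)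
    have h5 := qShifted_sq_ne_zero hq r
    have e2 : ∀ i, q ^ (j + 1) / q ^ (i + 1) = q ^ j / q ^ i := fun i => by
      rw [pow_succ, pow_succ, mul_div_mul_right _ _ hq0]
    rw [shiftCoeff, Finset.prod_range_succ', Finset.prod_congr rfl fun i _ => by rw [e2],
      show n + ν + 2 - (j + 1) = r by omega, show j + 1 + (n + 1) = j + n + 2 by omega,
      qShifted_succ _ _ r, qShifted_succ _ _ j, ← pow_succ', pow_zero, div_one,
      show q ^ 2 * (q ^ 2) ^ r = q ^ (2 * r + 1 + 1) by ring,
      show q ^ (2 * (r + 1)) = q ^ (2 * r + 1 + 1) by ring]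
    field_simp
  rw [e1]
  have e3 : q ^ (2 * (n + ν + 2)) = q ^ (n + ν + 2) * q ^ (n + ν + 2) := by rw [← pow_add]; ring
  rw [e3] at hjr
  linear_combination (-shiftBasis (n + ν + 2) h t q j z / qShifted q q (n + ν + 2)) * hjr

end

/-! ### The initial relation at `m = 0`, linking `t` and `t⁻¹`. -/

section

attribute [local irreducible] qShifted

variable {q h t z : ℂ}

/-- Used with `a = ht`, `c = -h/t`. These are the products produced by `awPoly_eq_sum` for the
parameters `a, a⁻¹, c, c⁻¹`. -/
noncomputable def reflBasis (N : ℕ) (a c q : ℂ) (i : ℕ) (z : ℂ) : ℂ :=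
  qShifted (a⁻¹ * z) q i * qShifted (c⁻¹ * z) q i *
    (qShifted (a / z) q (N - i) * qShifted (c / z) q (N - i)) * z ^ ((N : ℤ) - 2 * i)

theorem awPoly_eq_sum_reflBasis (hq0 : q ≠ 0) (hq : ∀ k, q ^ (k + 1) ≠ 1) {a c : ℂ}
    (hac : a * c = -q) (hz : z ≠ 0) (n : ℕ) :
    awPoly (n + 2) a a⁻¹ c c⁻¹ q z = ∑ i ∈ Finset.range (n + 2 + 1),
      qShifted (q ^ 2) (q ^ 2) (n + 2) * qShifted (-q) q n * ((1 + q ^ i / q) * (1 + q ^ i)) /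
        (qShifted (q ^ 2) (q ^ 2) i * qShifted (q ^ 2) (q ^ 2) (n + 2 - i)) *
        reflBasis (n + 2) a c q i z := by
  have ha : a ≠ 0 := by rintro rfl; apply hq0; linear_combination hac
  have hc : c ≠ 0 := by rintro rfl; apply hq0; linear_combination hac
  rw [awPoly_eq_sum hq0 hq ha (inv_ne_zero ha) (inv_ne_zero hc) hz, ← Finset.sum_range_reflect]
  refine Finset.sum_congr rfl fun i hi => ?_
  obtain ⟨r, hr⟩ := Nat.exists_eq_add_of_le (Nat.lt_succ_iff.1 (Finset.mem_range.1 hi))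
  rw [show n + 2 + 1 - 1 - i = r by omega, show n + 2 - r = i by omega, reflBasis,
    show n + 2 - i = r by omega, hac, ← mul_inv, hac]
  have hs : ∀ n, qShifted q q n ≠ 0 := fun n => qShifted_self_ne_zero hq
  have hn : ∀ n, qShifted (-q) q n ≠ 0 := fun n => qShifted_neg_ne_zero hq n
  have e1 : (2 * (r : ℤ) - ((n + 2 : ℕ) : ℤ)) = ((n + 2 : ℕ) : ℤ) - 2 * i := by
    rw [hr]; push_cast; ring
  have e2 := qShifted_add (-q) q r i
  rw [show r + i = n + 2 by omega] at e2
  have e3 : qShifted (-q) q n * ((1 + q ^ i / q) * (1 + q ^ i)) =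
      qShifted (-q) q i * qShifted ((-q)⁻¹ * q ^ i) q r := by
    have f2 := qShifted_add (-q)⁻¹ q i r
    -- The first two factors of `(-q⁻¹;q)_{k+2}` are `1 + q⁻¹` and `1 + 1`.
    have f3 : ∀ k, qShifted (-q)⁻¹ q (k + 2) = 2 * (1 + q⁻¹) * qShifted (-q) q k := fun k => by
      rw [qShifted_succ', qShifted_succ']
      have : (-q)⁻¹ * q = -1 := by field_simp
      rw [this, neg_one_mul, inv_neg]; ring
    have f4 := qShifted_succ (-q)⁻¹ q (i + 1)
    rw [qShifted_succ _ _ i, f3] at f4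
    rw [← hr, f3] at f2
    have h1 : 1 + q⁻¹ ≠ 0 := by
      have := neg_pow_ne_one hq 1
      intro e; apply this; field_simp at e; linear_combination e
    have h2 : (2 : ℂ) * (1 + q⁻¹) ≠ 0 := mul_ne_zero two_ne_zero h1
    have g1 : 1 - (-q)⁻¹ * q ^ i = 1 + q ^ i / q := by rw [inv_neg]; ring
    have g2 : 1 - (-q)⁻¹ * q ^ (i + 1) = 1 + q ^ i := by field_simp; ring
    rw [g1, g2] at f4
    refine mul_left_cancel₀ h2 ?_
    linear_combination ((1 + q ^ i / q) * (1 + q ^ i)) * f2 -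
      qShifted ((-q)⁻¹ * q ^ i) q r * f4
  rw [e1, mul_assoc (qShifted (q ^ 2) (q ^ 2) (n + 2)), e3, ← qShifted_mul_neg, ← qShifted_mul_neg,
    ← qShifted_mul_neg, e2]
  have := hs i
  have := hs r
  have := hn i
  have := hn r
  generalize z ^ (((n + 2 : ℕ) : ℤ) - 2 * (i : ℤ)) = zz
  have core : qShifted q q (n + 2) / (qShifted q q r * qShifted q q i) =
      qShifted q q (n + 2) * (qShifted (-q) q r * qShifted (-q) q i) /
        (qShifted q q i * qShifted (-q) q i * (qShifted q q r * qShifted (-q) q r)) := by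
    field_simp
  linear_combination (qShifted (a / z) q r * qShifted (c / z) q r * qShifted (a⁻¹ * z) q i *
    qShifted (c⁻¹ * z) q i * qShifted (-q * q ^ r) q i * qShifted ((-q)⁻¹ * q ^ i) q r * zz) * core

/-- As `h² = q`, the two linear factors are the ones preceding the factorials in `z`, which become
longer by one. -/
theorem mul_shiftBasis (hq0 : q ≠ 0) (hh : h ^ 2 = q) (ht : t ≠ 0) (hz : z ≠ 0) (l j : ℕ) :
    (1 - (h * t)⁻¹ * z) * (1 - (-(h / t))⁻¹ * z) / z * shiftBasis l h t q j z =
      reflBasis (l + 1) (h * t) (-(h / t)) q (j + 1) z := by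
  have hh0 : h ≠ 0 := by rintro rfl; exact hq0 (by rw [← hh]; ring)
  unfold shiftBasis reflBasis
  rw [Nat.add_sub_add_right, qShifted_succ', qShifted_succ',
    show (h * t)⁻¹ * z * q = z * (h / t) by rw [← hh]; field_simp,
    show (-(h / t))⁻¹ * z * q = -(z * (h * t)) by rw [← hh]; field_simp,
    show (((l + 1 : ℕ) : ℤ) - 2 * ((j + 1 : ℕ) : ℤ)) = ((l : ℤ) - 2 * j) - 1 by push_cast; ring,
    zpow_sub_one₀ hz]
  ring

/-- After the shift the factorials in `z` already begin one step earlier; the linear factors,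
rewritten in `1/z`, now lengthen the other two factorials. -/
theorem mul_shiftBasis_shift (hq0 : q ≠ 0) (hh : h ^ 2 = q) (ht : t ≠ 0) (hz : z ≠ 0) {l j : ℕ}
    (hj : j ≤ l) :
    (1 - (h * t)⁻¹ * z) * (1 - (-(h / t))⁻¹ * z) / z * shiftBasis l h t q j (q⁻¹ * z) =
      -(q ^ (2 * j) / q ^ (l + 1)) * reflBasis (l + 1) (h * t) (-(h / t)) q j z := by
  have hh0 : h ≠ 0 := by rintro rfl; exact hq0 (by rw [← hh]; ring)
  unfold shiftBasis reflBasis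
  rw [Nat.succ_sub hj, qShifted_succ' (h * t / z), qShifted_succ' (-(h / t) / z),
    show q⁻¹ * z * (h / t) = (h * t)⁻¹ * z by rw [← hh]; field_simp,
    show -(q⁻¹ * z * (h * t)) = (-(h / t))⁻¹ * z by rw [← hh]; field_simp,
    show h * t / (q⁻¹ * z) = h * t / z * q by field_simp,
    show -(h / t) / (q⁻¹ * z) = -(h / t) / z * q by field_simp,
    show (((l + 1 : ℕ) : ℤ) - 2 * (j : ℤ)) = ((l : ℤ) - 2 * j) + 1 by push_cast; ring,
    zpow_add_one₀ hz, mul_zpow, inv_zpow,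
    show ((l : ℤ) - 2 * j) = (l : ℤ) - ((2 * j : ℕ) : ℤ) by push_cast; ring, zpow_sub₀ hq0,
    zpow_natCast, zpow_natCast]
  generalize z ^ ((l : ℤ) - ((2 * j : ℕ) : ℤ)) = zz
  have core : (1 - (h * t)⁻¹ * z) * (1 - (-(h / t))⁻¹ * z) / z * (q ^ l / q ^ (2 * j))⁻¹ =
      -(q ^ (2 * j) / q ^ (l + 1)) * ((1 - h * t / z) * (1 - -(h / t) / z) * z) := by
    rw [pow_succ]
    have h1 := pow_ne_zero (2 * j) hq0
    have h2 := pow_ne_zero l hq0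
    generalize q ^ (2 * j) = x at *
    generalize q ^ l = y at *
    rw [← hh]
    field_simp
    ring
  linear_combination (zz * (qShifted ((h * t)⁻¹ * z) q j * qShifted ((-(h / t))⁻¹ * z) q j *
    qShifted (h * t / z * q) q (l - j) * qShifted (-(h / t) / z * q) q (l - j))) * core

/-- This is `awPoly_add_two_inv` read backwards for `a = ht`, `c = -h/t`: the prefactor of the
summand supplies `(1 - az)(1 - cz)` and the multiplier supplies `(1 - a/z)(1 - c/z)`, up to a
monomial. -/
theorem mul_jacobiSummand_one_inv (hq0 : q ≠ 0) (hq : ∀ k, q ^ (k + 1) ≠ 1) (hh : h ^ 2 = q)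
    (ht : t ≠ 0) (hz : z ≠ 0) (n : ℕ) :
    (1 - (h * t)⁻¹ * z) * (1 - (-(h / t))⁻¹ * z) / z * jacobiSummand (n + 1) 1 h t⁻¹ q z =
      awPoly (n + 2) (h * t) (h * t)⁻¹ (-(h / t)) (-(h / t))⁻¹ q z / (1 - q ^ (n + 1)) := by
  have hh0 : h ≠ 0 := by rintro rfl; exact hq0 (by rw [← hh]; ring)
  have ha : h * t ≠ 0 := mul_ne_zero hh0 ht
  have hc : -(h / t) ≠ 0 := neg_ne_zero.2 (div_ne_zero hh0 ht)
  have h1 := one_sub_pow_ne_zero hq n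
  rw [eq_div_iff h1, awPoly_add_two_inv hq0 hq ha hc hz, jacobiSummand]
  have e1 : q / (h * t) = h * t⁻¹ := by rw [← hh]; field_simp
  have e2 : h * t * q = h * q ^ 1 / t⁻¹ := by field_simp
  have e3 : q / -(h / t) = -(h / t⁻¹) := by rw [← hh]; field_simp
  have e4 : -(h / t) * q = -(h * t⁻¹ * q ^ 1) := by field_simp
  rw [e1, e2, e3, e4, Nat.add_sub_cancel]
  generalize awPoly n _ _ _ _ q z = w
  simp only [qShifted_succ, qShifted_zero, pow_zero, pow_one, mul_one, one_mul]
  have core : (1 - (h * t)⁻¹ * z) * (1 - (-(h / t))⁻¹ * z) / z * z⁻¹ =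
      (h * t * -(h / t))⁻¹ * ((1 - h * t / z) * (1 - -(h / t) / z)) := by
    field_simp
    ring
  rw [show z * (h / t⁻¹) = h * t * z by field_simp, show -(z * (h * t⁻¹)) = -(h / t) * z by field_simp]
  linear_combination (w * (1 - q ^ (n + 1)) * (1 - q ^ (n + 2)) * (1 - h * t * z) *
    (1 - -(h / t) * z)) * core

/-- Comparison of coefficients in `reflBasis`. Over a common denominator their `i`-dependence is `1
- q^{2i}` for `m = 0`, `(1 - q^i)(1 - q^{i-1})` for `m = 1`, and `(1 + q^i)(1 + q^{i-1})` for `m =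
1` with `t⁻¹`. -/
theorem jacobiSummand_initial_of_ne (hq0 : q ≠ 0) (hq : ∀ k, q ^ (k + 1) ≠ 1) (hh : h ^ 2 = q)
    (ht : t ≠ 0) (hz : z ≠ 0) (n : ℕ) (h1 : z ≠ h * t) (h2 : z ≠ -(h / t)) :
    (q ^ (n + 1))⁻¹ * jacobiSummand (n + 1) 0 h t q (q⁻¹ * z) =
      (1 - 2 * hahnUp (n + 1) q 0) * jacobiSummand (n + 1) 0 h t q z +
        hahnUp (n + 1) q 0 *
          (jacobiSummand (n + 1) 1 h t q z + jacobiSummand (n + 1) 1 h t⁻¹ q z) := by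
  have hh0 : h ≠ 0 := by rintro rfl; exact hq0 (by rw [← hh]; ring)
  have ha : h * t ≠ 0 := mul_ne_zero hh0 ht
  have hc : -(h / t) ≠ 0 := neg_ne_zero.2 (div_ne_zero hh0 ht)
  have hz' : q⁻¹ * z ≠ 0 := mul_ne_zero (inv_ne_zero hq0) hz
  have hs : ∀ n, qShifted q q n ≠ 0 := fun n => qShifted_self_ne_zero hq
  have hn : ∀ n, qShifted (-q) q n ≠ 0 := fun n => qShifted_neg_ne_zero hq n
  have hp : ∀ n, qShifted (q ^ 2) (q ^ 2) n ≠ 0 := fun n => qShifted_sq_ne_zero hq n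
  have hD : (1 - (h * t)⁻¹ * z) * (1 - (-(h / t))⁻¹ * z) / z ≠ 0 := by
    refine div_ne_zero (mul_ne_zero ?_ ?_) hz
    · exact sub_ne_zero.2 fun e => h1 (by rw [eq_inv_mul_iff_mul_eq₀ ha, mul_one] at e; exact e.symm)
    · exact sub_ne_zero.2 fun e => h2 (by rw [eq_inv_mul_iff_mul_eq₀ hc, mul_one] at e; exact e.symm)
  refine mul_left_cancel₀ hD ?_
  have k0 : ∀ j, shiftCoeff (n + 1) q 0 j =
      1 / (qShifted (q ^ 2) (q ^ 2) j * qShifted (q ^ 2) (q ^ 2) (n + 1 - j)) := fun j => by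
    rw [shiftCoeff, add_zero, qShifted_mul_neg, Finset.prod_range_zero]
  have g0 : (1 - (h * t)⁻¹ * z) * (1 - (-(h / t))⁻¹ * z) / z * jacobiSummand (n + 1) 0 h t q z =
      ∑ i ∈ Finset.range (n + 2 + 1), qShifted (q ^ 2) (q ^ 2) (n + 1) ^ 2 / qShifted q q (n + 1) *
        ((1 - q ^ (2 * i)) / (qShifted (q ^ 2) (q ^ 2) i * qShifted (q ^ 2) (q ^ 2) (n + 2 - i)) *
        reflBasis (n + 2) (h * t) (-(h / t)) q i z) := by
    rw [Finset.sum_range_succ', mul_zero, pow_zero, sub_self, zero_div, zero_mul, mul_zero, add_zero,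
      jacobiSummand_eq_sum hq0 hq hh ht hz (Nat.zero_le _), Finset.mul_sum, Finset.mul_sum]
    refine Finset.sum_congr rfl fun i _ => ?_
    rw [← mul_shiftBasis hq0 hh ht hz, k0, qShifted_succ (q ^ 2) (q ^ 2) i, ← pow_succ', ← pow_mul,
      show n + 2 - (i + 1) = n + 1 - i by omega, Nat.sub_zero, add_zero]
    have := one_sub_pow_ne_zero hq (2 * i + 1)
    rw [show 2 * i + 1 + 1 = 2 * (i + 1) by ring] at this
    have e : (1 - q ^ (2 * (i + 1))) / (qShifted (q ^ 2) (q ^ 2) i * (1 - q ^ (2 * (i + 1))) *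
        qShifted (q ^ 2) (q ^ 2) (n + 1 - i)) =
        1 / (qShifted (q ^ 2) (q ^ 2) i * qShifted (q ^ 2) (q ^ 2) (n + 1 - i)) := by
      rw [mul_right_comm, div_mul_cancel_right₀ this, one_div]
    rw [e]
    ring
  have g1 : (1 - (h * t)⁻¹ * z) * (1 - (-(h / t))⁻¹ * z) / z * jacobiSummand (n + 1) 1 h t q z =
      ∑ i ∈ Finset.range (n + 2 + 1), qShifted (q ^ 2) (q ^ 2) n * qShifted (q ^ 2) (q ^ 2) (n + 2) /
        qShifted q q (n + 1) * ((1 - q ^ i) * (1 - q ^ i / q) /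
        (qShifted (q ^ 2) (q ^ 2) i * qShifted (q ^ 2) (q ^ 2) (n + 2 - i)) *
        reflBasis (n + 2) (h * t) (-(h / t)) q i z) := by
    rw [Finset.sum_range_succ', pow_zero, sub_self, zero_mul, zero_div, zero_mul, mul_zero, add_zero,
      jacobiSummand_eq_sum hq0 hq hh ht hz (Nat.le_add_left _ _), Finset.mul_sum, Finset.mul_sum]
    refine Finset.sum_congr rfl fun i _ => ?_
    have := one_sub_pow_ne_zero hq i
    rw [← mul_shiftBasis hq0 hh ht hz, ← qShifted_mul_neg q q (i + 1), qShifted_succ q q i, ← pow_succ',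
      show n + 2 - (i + 1) = n + 1 - i by omega, shiftCoeff, Nat.add_sub_cancel,
      Finset.prod_range_one, pow_zero, div_one, pow_succ q i, mul_div_cancel_right₀ _ hq0,
      ← pow_succ q i]
    have e : (1 - q ^ (i + 1)) * (1 - q ^ i) / (qShifted q q i * (1 - q ^ (i + 1)) *
        qShifted (-q) q (i + 1) * qShifted (q ^ 2) (q ^ 2) (n + 1 - i)) =
        (1 - q ^ i) / (qShifted q q i * qShifted (-q) q (i + 1) *
          qShifted (q ^ 2) (q ^ 2) (n + 1 - i)) := by
      rw [mul_right_comm (qShifted q q i), mul_right_comm _ (1 - q ^ (i + 1)), mul_comm (1 - q ^ (i + 1)),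
        mul_div_mul_right _ _ this]
    rw [e]
    ring
  have gs : (1 - (h * t)⁻¹ * z) * (1 - (-(h / t))⁻¹ * z) / z *
      jacobiSummand (n + 1) 0 h t q (q⁻¹ * z) =
      ∑ i ∈ Finset.range (n + 2 + 1), qShifted (q ^ 2) (q ^ 2) (n + 1) ^ 2 / qShifted q q (n + 1) *
        (-(q ^ (2 * i) / q ^ (n + 2)) * (1 - q ^ (2 * (n + 2 - i))) /
        (qShifted (q ^ 2) (q ^ 2) i * qShifted (q ^ 2) (q ^ 2) (n + 2 - i)) *
        reflBasis (n + 2) (h * t) (-(h / t)) q i z) := by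
    rw [Finset.sum_range_succ, Nat.sub_self, mul_zero, pow_zero, sub_self, mul_zero, zero_div,
      zero_mul, mul_zero, add_zero, jacobiSummand_eq_sum hq0 hq hh ht hz' (Nat.zero_le _),
      Finset.mul_sum, Finset.mul_sum]
    refine Finset.sum_congr rfl fun i hi => ?_
    obtain ⟨r, hr⟩ := Nat.exists_eq_add_of_le (Nat.lt_succ_iff.1 (Finset.mem_range.1 hi))
    have hr2 : n + 2 - i = r + 1 := by omega
    have hm := mul_shiftBasis_shift hq0 hh ht hz (l := n + 1)
      (Nat.lt_succ_iff.1 (Finset.mem_range.1 hi))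
    rw [k0, hr2, show n + 1 - i = r by omega, Nat.sub_zero, add_zero,
      qShifted_succ (q ^ 2) (q ^ 2) r, ← pow_succ', ← pow_mul]
    have := one_sub_pow_ne_zero hq (2 * r + 1)
    rw [show 2 * r + 1 + 1 = 2 * (r + 1) by ring] at this
    have e : (1 - q ^ (2 * (r + 1))) / (qShifted (q ^ 2) (q ^ 2) i * (qShifted (q ^ 2) (q ^ 2) r *
        (1 - q ^ (2 * (r + 1))))) =
        1 / (qShifted (q ^ 2) (q ^ 2) i * qShifted (q ^ 2) (q ^ 2) r) := by
      rw [← mul_assoc, div_mul_cancel_right₀ this, one_div]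
    rw [mul_div_assoc (-(q ^ (2 * i) / q ^ (n + 2))), e]
    linear_combination (qShifted (q ^ 2) (q ^ 2) (n + 1) * qShifted (q ^ 2) (q ^ 2) (n + 1) /
      qShifted q q (n + 1) * (1 / (qShifted (q ^ 2) (q ^ 2) i * qShifted (q ^ 2) (q ^ 2) r))) * hm
  rw [mul_left_comm, gs, mul_add, mul_left_comm, g0, mul_left_comm _ (hahnUp _ _ _), mul_add, g1,
    mul_jacobiSummand_one_inv hq0 hq hh ht hz,
    awPoly_eq_sum_reflBasis hq0 hq (by rw [← hh]; field_simp) hz, Finset.sum_div,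
    ← Finset.sum_add_distrib, Finset.mul_sum, Finset.mul_sum, Finset.mul_sum,
    ← Finset.sum_add_distrib]
  refine Finset.sum_congr rfl fun i hi => ?_
  obtain ⟨r, hr⟩ := Nat.exists_eq_add_of_le (Nat.lt_succ_iff.1 (Finset.mem_range.1 hi))
  have e1 : q ^ (2 * (n + 2 - i)) = q ^ (2 * (n + 2)) / q ^ (2 * i) := by
    rw [eq_div_iff (pow_ne_zero _ hq0), ← pow_add]; congr 1; omega
  have core : (q ^ (n + 1))⁻¹ * (qShifted (q ^ 2) (q ^ 2) (n + 1) ^ 2 / qShifted q q (n + 1) *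
      (-(q ^ (2 * i) / q ^ (n + 2)) * (1 - q ^ (2 * (n + 2 - i))))) =
      (1 - 2 * hahnUp (n + 1) q 0) * (qShifted (q ^ 2) (q ^ 2) (n + 1) ^ 2 / qShifted q q (n + 1) *
        (1 - q ^ (2 * i))) + hahnUp (n + 1) q 0 *
        (qShifted (q ^ 2) (q ^ 2) n * qShifted (q ^ 2) (q ^ 2) (n + 2) / qShifted q q (n + 1) *
          ((1 - q ^ i) * (1 - q ^ i / q)) +
        qShifted (q ^ 2) (q ^ 2) (n + 2) * qShifted (-q) q n * ((1 + q ^ i / q) * (1 + q ^ i)) /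
          (1 - q ^ (n + 1))) := by
    rw [e1, hahnUp, qShifted_succ _ _ (n + 1), qShifted_succ (q ^ 2) _ n, ← qShifted_mul_neg,
      qShifted_succ q q n, ← pow_succ' q]
    have h3 := one_sub_pow_ne_zero hq n
    have h4 := hs n
    have h5 := neg_pow_ne_one hq 1
    simp only [mul_zero, pow_zero, zero_add, pow_one] at *
    generalize qShifted q q n = S at *
    generalize qShifted (-q) q n = S' at *
    rw [show (q ^ 2) ^ n = (q ^ n) ^ 2 by ring, show (q ^ 2) ^ (n + 1) = (q * q ^ n) ^ 2 by ring,
      show q ^ (2 * i) = (q ^ i) ^ 2 by ring, show q ^ (2 * (n + 2)) = (q ^ 2 * q ^ n) ^ 2 by ring,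
      show q ^ (n + 2) = q ^ 2 * q ^ n by ring, show q ^ (2 * (n + 1)) = (q * q ^ n) ^ 2 by ring]
    rw [show q ^ (n + 1) = q * q ^ n by ring] at *
    have h6 := pow_ne_zero n hq0
    have h7 := pow_ne_zero i hq0
    generalize q ^ n = x at *
    generalize q ^ i = u at *
    field_simp
    ring
  linear_combination (reflBasis (n + 2) (h * t) (-(h / t)) q i z / (qShifted (q ^ 2) (q ^ 2) i *
    qShifted (q ^ 2) (q ^ 2) (n + 2 - i))) * core

theorem continuousAt_qShifted {f : ℂ → ℂ} (hf : ContinuousAt f z) (n : ℕ) :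
    ContinuousAt (fun w => qShifted (f w) q n) z := by
  induction n with
  | zero => simpa using continuousAt_const
  | succ n ih => simp only [qShifted_succ]; fun_prop

theorem continuousAt_jacobiSummand (hz : z ≠ 0) (l m : ℕ) (h t q : ℂ) :
    ContinuousAt (fun w => jacobiSummand l m h t q w) z := by
  have h1 : ∀ a : ℂ, ContinuousAt (fun w => a / w) z := fun a => by fun_prop (disch := exact hz)
  have h2 : ContinuousAt (fun w : ℂ => (w ^ m)⁻¹) z := by
    fun_prop (disch := exact pow_ne_zero _ hz)
  have h3 := fun a k => continuousAt_qShifted (q := q) (h1 a) k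
  have h4 := fun (a : ℂ) k => continuousAt_qShifted (q := q) (z := z) (f := fun w => a * w)
    (by fun_prop) k
  have h5 := fun (a : ℂ) k => continuousAt_qShifted (q := q) (z := z) (f := fun w => w * a)
    (by fun_prop) k
  have h6 := fun (a : ℂ) k => continuousAt_qShifted (q := q) (z := z) (f := fun w => -(w * a))
    (by fun_prop) k
  unfold jacobiSummand awPoly
  fun_prop

theorem jacobiSummand_initial (hq0 : q ≠ 0) (hq : ∀ k, q ^ (k + 1) ≠ 1) (hh : h ^ 2 = q)
    (ht : t ≠ 0) (hz : z ≠ 0) (n : ℕ) :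
    (q ^ (n + 1))⁻¹ * jacobiSummand (n + 1) 0 h t q (q⁻¹ * z) =
      (1 - 2 * hahnUp (n + 1) q 0) * jacobiSummand (n + 1) 0 h t q z +
        hahnUp (n + 1) q 0 *
          (jacobiSummand (n + 1) 1 h t q z + jacobiSummand (n + 1) 1 h t⁻¹ q z) := by
  have hz' : q⁻¹ * z ≠ 0 := mul_ne_zero (inv_ne_zero hq0) hz
  have c1 := fun m t => (continuousAt_jacobiSummand hz (n + 1) m h t q).continuousWithinAt
    (s := {z}ᶜ)
  have c2 : ContinuousWithinAt (fun w => jacobiSummand (n + 1) 0 h t q (q⁻¹ * w)) {z}ᶜ z :=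
    (ContinuousAt.comp (f := fun w => q⁻¹ * w) (continuousAt_jacobiSummand hz' (n + 1) 0 h t q)
      (by fun_prop)).continuousWithinAt
  refine tendsto_nhds_unique_of_eventuallyEq
    (c2.const_mul (q ^ (n + 1))⁻¹)
    (((c1 0 t).const_mul _).add (((c1 1 t).add (c1 1 t⁻¹)).const_mul _)) ?_
  -- Both sides are continuous at `z`, so agreement on a punctured neighbourhood avoiding `0`, `ht`
  -- and `-h/t` suffices.
  have ne : ∀ a : ℂ, ∀ᶠ w in nhdsWithin z {z}ᶜ, w ≠ a := fun a => by
    by_cases h : z = a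
    · subst h; exact self_mem_nhdsWithin
    · exact nhdsWithin_le_nhds (isOpen_ne.mem_nhds h)
  filter_upwards [ne 0, ne (h * t), ne (-(h / t))] with w w0 w1 w2
  exact jacobiSummand_initial_of_ne hq0 hq hh ht w0 n w1 w2

end

/-! ### The `q`-Hahn recurrence and the reduction of operator identities to it. -/

section

attribute [local irreducible] qShifted

variable {q : ℂ}

/-- The coefficients of the `q`-Hahn polynomial with `a = b = q⁻¹` in base `q²`, as functions
of `M = q^{2m}`. -/
noncomputable def hahnCoeff (l : ℕ) (q M : ℂ) (k : ℕ) : ℂ :=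
  qShifted M⁻¹ (q ^ 2) k * qShifted M (q ^ 2) k /
    (qShifted q (q ^ 2) k * qShifted (q ^ (2 * l))⁻¹ (q ^ 2) k * qShifted (q ^ 2) (q ^ 2) k) *
    (q ^ 2) ^ k

/-- Since `abq² = 1` in base `q`, i.e. the upper parameters are `M⁻¹` and `M`, the polynomial
formally attached to `m = -1` equals the one for `m = 1`. -/
theorem hahnCoeff_inv (l : ℕ) (q M : ℂ) (k : ℕ) : hahnCoeff l q M⁻¹ k = hahnCoeff l q M k := by
  unfold hahnCoeff
  rw [inv_inv, mul_comm (qShifted M _ _)]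

theorem qShifted_pow_inv_eq_zero (hq0 : q ≠ 0) {m k : ℕ} (h : m < k) :
    qShifted (q ^ m)⁻¹ q k = 0 := by
  unfold qShifted
  exact Finset.prod_eq_zero (Finset.mem_range.2 h)
    (by rw [inv_mul_cancel₀ (pow_ne_zero _ hq0), sub_self])

theorem hahn_core {M L : ℂ} (hq0 : q ≠ 0) (hM : M ≠ 0) (hL : L ≠ 0) (h1 : 1 + M ≠ 0)
    (h2 : 1 + q * M ≠ 0) (h3 : q + M ≠ 0) (k : ℕ) :
    qShifted M⁻¹ (q ^ 2) (k + 1) * qShifted M (q ^ 2) (k + 1) -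
      qShifted M⁻¹ (q ^ 2) k * qShifted M (q ^ 2) k *
        ((1 - q * (q ^ 2) ^ k) * (1 - L⁻¹ * (q ^ 2) ^ k) * (1 - q ^ 2 * (q ^ 2) ^ k)) =
    (q ^ 2) ^ (k + 1) *
      ((1 - M / L) / ((1 + M) * (1 + q * M)) * (qShifted (q ^ 2 * M)⁻¹ (q ^ 2) (k + 1) *
          qShifted (q ^ 2 * M) (q ^ 2) (k + 1)) +
        (1 - (1 - M / L) / ((1 + M) * (1 + q * M)) -
          -(M / L) * (1 - M * L) / ((q + M) * (1 + M))) *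
          (qShifted M⁻¹ (q ^ 2) (k + 1) * qShifted M (q ^ 2) (k + 1)) +
        -(M / L) * (1 - M * L) / ((q + M) * (1 + M)) *
          (qShifted (M / q ^ 2)⁻¹ (q ^ 2) (k + 1) * qShifted (M / q ^ 2) (q ^ 2) (k + 1))) := by
  have h4 : 1 + M * q ≠ 0 := by rwa [mul_comm]
  -- For positive `k` all the products share `(q²/M;q²)_{k-1}` and `(q²M;q²)_{k-1}`; at `k = 0`
  -- there is no such common part.
  rcases k with _ | k
  · simp only [zero_add, qShifted_succ, qShifted_zero, pow_zero, mul_one, one_mul, pow_one]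
    field_simp
    ring
  · have e1 : qShifted (q ^ 2 * M)⁻¹ (q ^ 2) (k + 1 + 1) =
        (1 - (q ^ 2 * M)⁻¹) * ((1 - M⁻¹) * qShifted (q ^ 2 / M) (q ^ 2) k) := by
      rw [qShifted_succ', qShifted_succ', show (q ^ 2 * M)⁻¹ * q ^ 2 = M⁻¹ by field_simp,
        show M⁻¹ * q ^ 2 = q ^ 2 / M by field_simp]
    have e2 : qShifted M⁻¹ (q ^ 2) (k + 1) = (1 - M⁻¹) * qShifted (q ^ 2 / M) (q ^ 2) k := by
      rw [qShifted_succ', show M⁻¹ * q ^ 2 = q ^ 2 / M by field_simp]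
    have e3 : qShifted (M / q ^ 2)⁻¹ (q ^ 2) (k + 1 + 1) = qShifted (q ^ 2 / M) (q ^ 2) k *
        (1 - q ^ 2 / M * (q ^ 2) ^ k) * (1 - q ^ 2 / M * (q ^ 2) ^ (k + 1)) := by
      rw [inv_div, qShifted_succ, qShifted_succ]
    have f1 : qShifted (M / q ^ 2) (q ^ 2) (k + 1 + 1) =
        (1 - M / q ^ 2) * ((1 - M) * qShifted (q ^ 2 * M) (q ^ 2) k) := by
      rw [qShifted_succ', qShifted_succ', show M / q ^ 2 * q ^ 2 = M by field_simp,
        mul_comm M]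
    have f2 : qShifted M (q ^ 2) (k + 1) = (1 - M) * qShifted (q ^ 2 * M) (q ^ 2) k := by
      rw [qShifted_succ', mul_comm M]
    rw [e1, e3, f1, qShifted_succ (q ^ 2 * M) _ (k + 1), qShifted_succ (q ^ 2 * M) _ k,
      qShifted_succ M _ (k + 1), qShifted_succ M⁻¹ _ (k + 1), e2, f2, pow_succ _ (k + 1), pow_succ _ k]
    generalize qShifted (q ^ 2 / M) (q ^ 2) k = A
    generalize qShifted (q ^ 2 * M) (q ^ 2) k = B
    have hu := pow_ne_zero k (pow_ne_zero 2 hq0)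
    generalize (q ^ 2) ^ k = u at *
    field_simp
    ring

/-- The coefficient of `(x;q²)_{k+1}` in the recurrence, the left-hand side coming from
`X_mul_qShiftedPoly`. The bound `k < l` keeps `(q^{-2l};q²)_{k+1}` nonzero. -/
theorem hahnCoeff_recurrence (hq0 : q ≠ 0) (hq : ∀ k, q ^ (k + 1) ≠ 1) {l m k : ℕ} (hk : k < l) :
    hahnCoeff l q (q ^ (2 * m)) (k + 1) / (q ^ 2) ^ (k + 1) -
      hahnCoeff l q (q ^ (2 * m)) k / (q ^ 2) ^ k =
    hahnUp l q m * hahnCoeff l q (q ^ 2 * q ^ (2 * m)) (k + 1) +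
      (1 - hahnUp l q m - hahnDown l q m) * hahnCoeff l q (q ^ (2 * m)) (k + 1) +
      hahnDown l q m * hahnCoeff l q (q ^ (2 * m) / q ^ 2) (k + 1) := by
  have h1 := neg_pow_ne_one hq (2 * m)
  have h2 : 1 + q * q ^ (2 * m) ≠ 0 := by rw [← pow_succ']; exact neg_pow_ne_one hq _
  have h3 : q + q ^ (2 * m) ≠ 0 := by
    rcases m with _ | m
    · have := neg_pow_ne_one hq 1
      intro e; apply this; simpa [add_comm] using e
    · have := mul_ne_zero hq0 (neg_pow_ne_one hq (2 * m + 1))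
      intro e; apply this; rw [← e]; ring
  have core := hahn_core hq0 (pow_ne_zero (2 * m) hq0) (pow_ne_zero (2 * l) hq0) h1 h2 h3 k
  unfold hahnCoeff hahnUp hahnDown
  rw [qShifted_succ q, qShifted_succ (q ^ (2 * l))⁻¹, qShifted_succ (q ^ 2), pow_succ' q (2 * m)]
  have d1 : ∀ k, qShifted q (q ^ 2) k ≠ 0 := fun k => qShifted_ne_zero fun i _ e =>
    hq (2 * i) (by rw [← e]; ring)
  have d2 := qShifted_sq_ne_zero hq (k + 1)
  have d3 : qShifted (q ^ (2 * l))⁻¹ (q ^ 2) (k + 1) ≠ 0 := qShifted_ne_zero fun i hi e => by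
    obtain ⟨r, rfl⟩ : ∃ r, l = i + r + 1 := ⟨l - i - 1, by omega⟩
    rw [inv_mul_eq_one₀ (pow_ne_zero _ hq0)] at e
    have : q ^ (2 * i) * (q ^ (2 * r + 1 + 1) - 1) = 0 := by
      rw [← pow_mul] at e; linear_combination e
    rcases mul_eq_zero.1 this with h | h
    · exact pow_ne_zero _ hq0 h
    · exact hq _ (sub_eq_zero.1 h)
  have d4 := d1 (k + 1)
  rw [qShifted_succ, mul_ne_zero_iff] at d2 d3 d4
  obtain ⟨a1, a2⟩ := d2
  obtain ⟨b1, b2⟩ := d3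
  obtain ⟨c1, c2⟩ := d4
  have hu := pow_ne_zero k (pow_ne_zero 2 hq0)
  have hu' := pow_ne_zero (k + 1) (pow_ne_zero 2 hq0)
  generalize 1 - q * (q ^ 2) ^ k = E1 at *
  generalize 1 - (q ^ (2 * l))⁻¹ * (q ^ 2) ^ k = E2 at *
  generalize 1 - q ^ 2 * (q ^ 2) ^ k = E3 at *
  generalize (1 - q ^ (2 * m) / q ^ (2 * l)) / ((1 + q ^ (2 * m)) * (1 + q * q ^ (2 * m))) = A at *
  generalize -(q ^ (2 * m) / q ^ (2 * l)) * (1 - q ^ (2 * m) * q ^ (2 * l)) /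
    ((q + q ^ (2 * m)) * (1 + q ^ (2 * m))) = B at *
  generalize qShifted q (q ^ 2) k = S1 at *
  generalize qShifted (q ^ (2 * l))⁻¹ (q ^ 2) k = S2 at *
  generalize qShifted (q ^ 2) (q ^ 2) k = S3 at *
  generalize qShifted (q ^ (2 * m))⁻¹ (q ^ 2) k = X1 at *
  generalize qShifted (q ^ (2 * m))⁻¹ (q ^ 2) (k + 1) = X2 at *
  generalize qShifted (q ^ (2 * m)) (q ^ 2) k = X3 at *
  generalize qShifted (q ^ (2 * m)) (q ^ 2) (k + 1) = X4 at *
  generalize qShifted (q ^ 2 * q ^ (2 * m))⁻¹ (q ^ 2) (k + 1) = X5 at *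
  generalize qShifted (q ^ 2 * q ^ (2 * m)) (q ^ 2) (k + 1) = X6 at *
  generalize qShifted (q ^ (2 * m) / q ^ 2)⁻¹ (q ^ 2) (k + 1) = X7 at *
  generalize qShifted (q ^ (2 * m) / q ^ 2) (q ^ 2) (k + 1) = X8 at *
  generalize (q ^ 2) ^ k = u at *
  generalize (q ^ 2) ^ (k + 1) = u' at *
  rw [mul_div_cancel_right₀ _ hu, mul_div_cancel_right₀ _ hu']
  have e : X1 * X3 / (S1 * S2 * S3) =
      X1 * X3 * (E1 * E2 * E3) / (S1 * E1 * (S2 * E2) * (S3 * E3)) := by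
    field_simp
  rw [e]
  linear_combination (1 / (S1 * E1 * (S2 * E2) * (S3 * E3))) * core

/-- The polynomial `(x;p)_k` in the variable `x`. -/
noncomputable def qShiftedPoly (p : ℂ) (k : ℕ) : ℂ[X] := ∏ i ∈ Finset.range k, (1 - C (p ^ i) * X)

theorem X_mul_qShiftedPoly {p : ℂ} (hp : p ≠ 0) (k : ℕ) :
    X * qShiftedPoly p k = C (p ^ k)⁻¹ * (qShiftedPoly p k - qShiftedPoly p (k + 1)) := by
  have : C (p ^ k)⁻¹ * C (p ^ k) = 1 := by
    rw [← C_mul, inv_mul_cancel₀ (pow_ne_zero _ hp), C_1]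
  rw [qShiftedPoly, qShiftedPoly, Finset.prod_range_succ]
  linear_combination (-X * ∏ i ∈ Finset.range k, (1 - C (p ^ i) * X)) * this

/-- Terms beyond `m` vanish because of `(q^{-2m};q²)_k`; a free upper bound `K` lets polynomials of
different degrees be compared term by term. -/
theorem qHahn_eq_sum (hq0 : q ≠ 0) (l : ℕ) {m K : ℕ} (hK : m < K) :
    qHahn m q⁻¹ q⁻¹ l (q ^ 2) =
      ∑ k ∈ Finset.range K, C (hahnCoeff l q (q ^ (2 * m)) k) * qShiftedPoly (q ^ 2) k := by
  obtain ⟨r, rfl⟩ := Nat.exists_eq_add_of_le (Nat.succ_le_of_lt hK)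
  rw [Finset.sum_range_add, Finset.sum_eq_zero (s := Finset.range r), add_zero]
  · unfold qHahn
    refine Finset.sum_congr rfl fun k _ => ?_
    have e1 : q⁻¹ * q⁻¹ * (q ^ 2) ^ (m + 1) = q ^ (2 * m) := by
      rw [pow_succ, ← pow_mul]; field_simp
    have e2 : q⁻¹ * q ^ 2 = q := by field_simp
    have e3 : ∀ n : ℕ, (q ^ 2) ^ (-(n : ℤ)) = (q ^ (2 * n))⁻¹ := fun n => by
      rw [zpow_neg, zpow_natCast, pow_mul]
    rw [e1, e2, e3, e3]
    rfl
  · intro k _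
    rw [hahnCoeff, pow_mul, qShifted_pow_inv_eq_zero (pow_ne_zero 2 hq0) (by omega), zero_mul,
      zero_div, zero_mul, C_0, zero_mul]

theorem X_mul_qHahn (hq0 : q ≠ 0) {l m : ℕ} :
    X * qHahn m q⁻¹ q⁻¹ l (q ^ 2) = C (hahnCoeff l q (q ^ (2 * m)) 0) +
      ∑ k ∈ Finset.range (m + 1), C (hahnCoeff l q (q ^ (2 * m)) (k + 1) / (q ^ 2) ^ (k + 1) -
        hahnCoeff l q (q ^ (2 * m)) k / (q ^ 2) ^ k) * qShiftedPoly (q ^ 2) (k + 1) := by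
  have hp : q ^ 2 ≠ 0 := pow_ne_zero 2 hq0
  have h1 : X * qHahn m q⁻¹ q⁻¹ l (q ^ 2) = ∑ k ∈ Finset.range (m + 2),
      C (hahnCoeff l q (q ^ (2 * m)) k / (q ^ 2) ^ k) * qShiftedPoly (q ^ 2) k -
      ∑ k ∈ Finset.range (m + 1),
        C (hahnCoeff l q (q ^ (2 * m)) k / (q ^ 2) ^ k) * qShiftedPoly (q ^ 2) (k + 1) := by
    have h0 : hahnCoeff l q (q ^ (2 * m)) (m + 1) = 0 := by
      rw [hahnCoeff, pow_mul, qShifted_pow_inv_eq_zero hp (Nat.lt_succ_self m), zero_mul,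
        zero_div, zero_mul]
    rw [Finset.sum_range_succ, h0, zero_div, C_0, zero_mul, add_zero, ← Finset.sum_sub_distrib,
      qHahn_eq_sum hq0 l (Nat.lt_succ_self m), Finset.mul_sum]
    refine Finset.sum_congr rfl fun k _ => ?_
    have := X_mul_qShiftedPoly hp k
    rw [div_eq_mul_inv, C_mul]
    linear_combination C (hahnCoeff l q (q ^ (2 * m)) k) * this
  rw [h1, Finset.sum_range_succ', add_sub_right_comm, ← Finset.sum_sub_distrib, add_comm]
  congr 1
  · simp [qShiftedPoly]
  · refine Finset.sum_congr rfl fun k _ => ?_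
    rw [C_sub, sub_mul]

theorem hahnCoeff_zero (l : ℕ) (q M : ℂ) : hahnCoeff l q M 0 = 1 := by simp [hahnCoeff]

theorem qHahn_recurrence (hq0 : q ≠ 0) (hq : ∀ k, q ^ (k + 1) ≠ 1) {l n : ℕ} (hn : n + 2 ≤ l) :
    X * qHahn (n + 1) q⁻¹ q⁻¹ l (q ^ 2) =
      C (hahnUp l q (n + 1)) * qHahn (n + 2) q⁻¹ q⁻¹ l (q ^ 2) +
      C (1 - hahnUp l q (n + 1) - hahnDown l q (n + 1)) * qHahn (n + 1) q⁻¹ q⁻¹ l (q ^ 2) +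
      C (hahnDown l q (n + 1)) * qHahn n q⁻¹ q⁻¹ l (q ^ 2) := by
  rw [X_mul_qHahn hq0, qHahn_eq_sum hq0 l (show n + 2 < n + 3 by omega),
    qHahn_eq_sum hq0 l (show n + 1 < n + 3 by omega), qHahn_eq_sum hq0 l (show n < n + 3 by omega)]
  simp only [Finset.sum_range_succ' _ (n + 2), hahnCoeff_zero, mul_add (C _), Finset.mul_sum]
  rw [Finset.sum_congr rfl fun k hk => by
    rw [hahnCoeff_recurrence hq0 hq (show k < l by have := Finset.mem_range.1 hk; omega)]]
  have e1 : q ^ 2 * q ^ (2 * (n + 1)) = q ^ (2 * (n + 2)) := by ring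
  have e2 : q ^ (2 * (n + 1)) / q ^ 2 = q ^ (2 * n) := by
    rw [div_eq_iff (pow_ne_zero 2 hq0)]; ring
  simp only [e1, e2, C_add, C_mul, add_mul, Finset.sum_add_distrib, C_sub, C_1, sub_mul,
    Finset.sum_sub_distrib, one_mul, mul_assoc]
  rw [show qShiftedPoly (q ^ 2) 0 = 1 from Finset.prod_range_zero _]
  ring

/-- The general coefficient recurrence at `m = 0`: the lower neighbour coincides with the upper one
by `hahnCoeff_inv`, and `hahnDown` equals `hahnUp` there. -/
theorem qHahn_recurrence_zero (hq0 : q ≠ 0) (hq : ∀ k, q ^ (k + 1) ≠ 1) {l : ℕ} (hl : 1 ≤ l) :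
    X * qHahn 0 q⁻¹ q⁻¹ l (q ^ 2) =
      C (2 * hahnUp l q 0) * qHahn 1 q⁻¹ q⁻¹ l (q ^ 2) +
      C (1 - 2 * hahnUp l q 0) * qHahn 0 q⁻¹ q⁻¹ l (q ^ 2) := by
  rw [X_mul_qHahn hq0, qHahn_eq_sum hq0 l (show 1 < 2 by omega),
    qHahn_eq_sum hq0 l (show 0 < 2 by omega)]
  have hd : hahnDown l q 0 = hahnUp l q 0 := by
    have h1 : 1 + q ≠ 0 := by simpa using neg_pow_ne_one hq 1
    have h2 : q + 1 ≠ 0 := by rwa [add_comm]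
    have := pow_ne_zero (2 * l) hq0
    simp only [hahnDown, hahnUp, mul_zero, pow_zero, zero_add, pow_one]
    field_simp
    ring
  have hr := hahnCoeff_recurrence hq0 hq (m := 0) (show 0 < l from hl)
  have e1 : (q ^ (2 * 0) / q ^ 2) = (q ^ (2 * 1))⁻¹ := by simp
  have e2 : q ^ 2 * q ^ (2 * 0) = q ^ (2 * 1) := by simp
  rw [e1, hahnCoeff_inv, hd, e2] at hr
  simp only [Finset.sum_range_succ, Finset.sum_range_zero, zero_add] at hr ⊢
  rw [hr, hahnCoeff_zero, hahnCoeff_zero]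
  simp only [C_add, C_mul, C_sub, C_1, qShiftedPoly, Finset.prod_range_zero, C_ofNat]
  ring

/-- Both sequences obey the same recurrence and start from `F 0`, so strong induction on `m`
identifies them, dividing by `hahnUp` at each step. Only nonzero `z` matter, since these are
preserved by the shift. -/
theorem aeval_qHahn_apply (hq0 : q ≠ 0) (hq : ∀ k, q ^ (k + 1) ≠ 1) (l : ℕ) (F : ℕ → ℂ → ℂ)
    (h0 : 1 ≤ l → ∀ z ≠ 0, (q ^ l)⁻¹ * F 0 (q⁻¹ * z) =
      2 * hahnUp l q 0 * F 1 z + (1 - 2 * hahnUp l q 0) * F 0 z)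
    (h1 : ∀ n, n + 2 ≤ l → ∀ z ≠ 0, (q ^ l)⁻¹ * F (n + 1) (q⁻¹ * z) =
      hahnUp l q (n + 1) * F (n + 2) z +
        (1 - hahnUp l q (n + 1) - hahnDown l q (n + 1)) * F (n + 1) z +
        hahnDown l q (n + 1) * F n z) {m : ℕ} (hm : m ≤ l) :
    ∀ z ≠ 0, (aeval (q ^ (-(l : ℤ)) • qShiftOp q) (qHahn m q⁻¹ q⁻¹ l (q ^ 2))) (F 0) z = F m z := by
  -- The numerator `1 - q^{2n-2l}` vanishes at `n = l`, so the division is possible exactly up to `m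
  -- = l`.
  have hup : ∀ n, n < l → hahnUp l q n ≠ 0 := fun n hn => by
    obtain ⟨r, rfl⟩ := Nat.exists_eq_add_of_lt hn
    refine div_ne_zero (fun e => ?_)
      (mul_ne_zero (neg_pow_ne_one hq _) (neg_pow_ne_one hq _))
    rw [sub_eq_zero, eq_div_iff (pow_ne_zero _ hq0), one_mul] at e
    refine hq (2 * r + 1) (mul_left_cancel₀ (pow_ne_zero (2 * n) hq0) ?_)
    rw [← pow_add, mul_one, ← e]
    congr 1
    ring
  have hX : ∀ (P : ℂ[X]) (z : ℂ), (aeval (q ^ (-(l : ℤ)) • qShiftOp q) (X * P)) (F 0) z =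
      (q ^ l)⁻¹ * (aeval (q ^ (-(l : ℤ)) • qShiftOp q) P) (F 0) (q⁻¹ * z) := fun P z => by
    rw [map_mul, aeval_X, zpow_neg, zpow_natCast]
    rfl
  have hC : ∀ (c : ℂ) (P : ℂ[X]) (z : ℂ), (aeval (q ^ (-(l : ℤ)) • qShiftOp q) (C c * P)) (F 0) z =
      c * (aeval (q ^ (-(l : ℤ)) • qShiftOp q) P) (F 0) z := fun c P z => by
    rw [← smul_eq_C_mul, map_smul]
    rfl
  have base : ∀ z ≠ 0, (aeval (q ^ (-(l : ℤ)) • qShiftOp q) (qHahn 0 q⁻¹ q⁻¹ l (q ^ 2))) (F 0) z =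
      F 0 z := fun z _ => by
    rw [qHahn_eq_sum hq0 l zero_lt_one]
    simp [hahnCoeff_zero, qShiftedPoly]
  have hq' : ∀ z : ℂ, z ≠ 0 → q⁻¹ * z ≠ 0 := fun z hz => mul_ne_zero (inv_ne_zero hq0) hz
  induction m using Nat.strong_induction_on with
  | _ m ih =>
    intro z hz
    rcases m with _ | _ | n
    · exact base z hz
    · have e := congrArg (fun P => (aeval (q ^ (-(l : ℤ)) • qShiftOp q) P) (F 0) z)
        (qHahn_recurrence_zero hq0 hq hm)
      simp only [hX, map_add, LinearMap.add_apply, Pi.add_apply, hC] at e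
      rw [base _ (hq' z hz), base _ hz, h0 hm z hz] at e
      exact (mul_left_cancel₀ (mul_ne_zero two_ne_zero (hup 0 hm)) (add_right_cancel e)).symm
    · have e := congrArg (fun P => (aeval (q ^ (-(l : ℤ)) • qShiftOp q) P) (F 0) z)
        (qHahn_recurrence hq0 hq hm)
      simp only [hX, map_add, LinearMap.add_apply, Pi.add_apply, hC] at e
      rw [ih (n + 1) (by omega) (by omega) _ (hq' z hz), ih (n + 1) (by omega) (by omega) _ hz,
        ih n (by omega) (by omega) _ hz, h1 n hm z hz] at e
      exact (mul_left_cancel₀ (hup (n + 1) hm) (add_right_cancel (add_right_cancel e))).symm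

end

/-! ### Continuous `q`-ultraspherical polynomials through their generating function. -/

section

attribute [local irreducible] qShifted

/-- `∑ₖ (β;p)ₖ/(p;p)ₖ (cX)ᵏ`. -/
noncomputable def qBinomialSeries (p β c : ℂ) : PowerSeries ℂ :=
  PowerSeries.mk fun k => qShifted β p k / qShifted p p k * c ^ k

/-- Heuristically the series is `(βcX;p)_∞ / (cX;p)_∞`, and raising `β` to `βp` drops the factor `1
- βcX`. The proof compares coefficients. -/
theorem qBinomialSeries_eq {p : ℂ} (hp : ∀ k, p ^ (k + 1) ≠ 1) (β c : ℂ) :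
    qBinomialSeries p β c =
      (1 - PowerSeries.C (β * c) * PowerSeries.X) * qBinomialSeries p (β * p) c := by
  ext k
  rcases k with _ | k
  · simp [qBinomialSeries]
  · rw [sub_mul, one_mul, mul_assoc, map_sub, PowerSeries.coeff_C_mul,
      PowerSeries.coeff_succ_X_mul]
    simp only [qBinomialSeries, PowerSeries.coeff_mk]
    rw [qShifted_succ', qShifted_succ (β * p), qShifted_succ p]
    have h1 := qShifted_self_ne_zero (n := k) hp
    have h2 : 1 - p * p ^ k ≠ 0 := by rw [← pow_succ']; exact one_sub_pow_ne_zero hp k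
    field_simp
    ring

/-- In the same product form, scaling `c` by `p` changes the denominator as well, leaving the factor
`1 - cX`. -/
theorem qBinomialSeries_mul {p : ℂ} (hp : ∀ k, p ^ (k + 1) ≠ 1) (β c : ℂ) :
    qBinomialSeries p β (p * c) =
      (1 - PowerSeries.C c * PowerSeries.X) * qBinomialSeries p (β * p) c := by
  ext k
  rcases k with _ | k
  · simp [qBinomialSeries]
  · rw [sub_mul, one_mul, mul_assoc, map_sub, PowerSeries.coeff_C_mul,
      PowerSeries.coeff_succ_X_mul]
    simp only [qBinomialSeries, PowerSeries.coeff_mk]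
    rw [qShifted_succ', qShifted_succ (β * p), qShifted_succ p]
    have h1 := qShifted_self_ne_zero (n := k) hp
    have h2 : 1 - p * p ^ k ≠ 0 := by rw [← pow_succ']; exact one_sub_pow_ne_zero hp k
    field_simp
    ring

/-- The generating function of the ultraspherical polynomials. The free scale `r` allows the two
arguments to be rescaled unequally, which is how the shift of `z` enters. -/
theorem coeff_qBinomialSeries_mul {x y r z : ℂ} (p β : ℂ) (hz : z ≠ 0) (hx : x = r * z⁻¹)
    (hy : y = r * z) (n : ℕ) :
    PowerSeries.coeff n (qBinomialSeries p β x * qBinomialSeries p β y) =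
      r ^ n * qUltraspherical n β p z := by
  subst hx hy
  rw [PowerSeries.coeff_mul, Finset.Nat.sum_antidiagonal_eq_sum_range_succ_mk, qUltraspherical,
    Finset.mul_sum]
  refine Finset.sum_congr rfl fun k hk => ?_
  obtain ⟨j, rfl⟩ := Nat.exists_eq_add_of_le (Nat.lt_succ_iff.1 (Finset.mem_range.1 hk))
  simp only [qBinomialSeries, PowerSeries.coeff_mk, Nat.add_sub_cancel_left]
  rw [show (((k + j : ℕ) : ℤ) - 2 * k) = (j : ℤ) - k by push_cast; ring, zpow_sub₀ hz,
    zpow_natCast, zpow_natCast, mul_pow, mul_pow, inv_pow, pow_add]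
  ring

theorem coeff_one_sub_mul_one_sub_mul (a b : ℂ) (H : PowerSeries ℂ) (n : ℕ) :
    PowerSeries.coeff n ((1 - PowerSeries.C a * PowerSeries.X) *
      (1 - PowerSeries.C b * PowerSeries.X) * H) =
    PowerSeries.coeff n H - (a + b) * PowerSeries.coeff n (PowerSeries.X * H) +
      a * b * PowerSeries.coeff n (PowerSeries.X * (PowerSeries.X * H)) := by
  rw [show (1 - PowerSeries.C a * PowerSeries.X) * (1 - PowerSeries.C b * PowerSeries.X) * H =
    H - PowerSeries.C (a + b) * (PowerSeries.X * H) +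
      PowerSeries.C (a * b) * (PowerSeries.X * (PowerSeries.X * H)) by
    rw [map_add, map_mul]; ring]
  rw [map_add, map_sub, PowerSeries.coeff_C_mul, PowerSeries.coeff_C_mul]

variable {q z : ℂ}

theorem sq_pow_ne_one (hq : ∀ k, q ^ (k + 1) ≠ 1) (k : ℕ) : (q ^ 2) ^ (k + 1) ≠ 1 := by
  rw [← pow_mul]; exact hq (2 * k + 1)

/-- Relations between ultraspherical polynomials with parameters `β` and `βq²`; here `h`, `h'`, `h''`
stand for the polynomials of degrees `n`, `n - 1`, `n - 2` with parameter `βq²`. -/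
theorem qUltraspherical_relations (hq0 : q ≠ 0) (hq : ∀ k, q ^ (k + 1) ≠ 1) (hz : z ≠ 0) (β : ℂ)
    (n : ℕ) {H : PowerSeries ℂ}
    (hH : H = qBinomialSeries (q ^ 2) (β * q ^ 2) z⁻¹ * qBinomialSeries (q ^ 2) (β * q ^ 2) z) :
    (qUltraspherical n β (q ^ 2) z = PowerSeries.coeff n H -
        β * (z + z⁻¹) * PowerSeries.coeff n (PowerSeries.X * H) +
        β ^ 2 * PowerSeries.coeff n (PowerSeries.X * (PowerSeries.X * H))) ∧
    ((q ^ 2) ^ n * qUltraspherical n β (q ^ 2) z = PowerSeries.coeff n H -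
        (z + z⁻¹) * PowerSeries.coeff n (PowerSeries.X * H) +
        PowerSeries.coeff n (PowerSeries.X * (PowerSeries.X * H))) ∧
    (q ^ n * qUltraspherical n β (q ^ 2) (q⁻¹ * z) = PowerSeries.coeff n H -
        (z⁻¹ + β * z) * PowerSeries.coeff n (PowerSeries.X * H) +
        β * PowerSeries.coeff n (PowerSeries.X * (PowerSeries.X * H))) := by
  have hp := sq_pow_ne_one hq
  refine ⟨?_, ?_, ?_⟩
  · have := coeff_qBinomialSeries_mul (q ^ 2) β hz (one_mul z⁻¹).symm (one_mul z).symm n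
    rw [one_pow, one_mul] at this
    rw [← this, qBinomialSeries_eq hp, qBinomialSeries_eq hp β z, mul_mul_mul_comm, ← hH,
      coeff_one_sub_mul_one_sub_mul]
    field_simp
    ring
  · rw [← coeff_qBinomialSeries_mul (q ^ 2) β hz rfl rfl n, qBinomialSeries_mul hp,
      qBinomialSeries_mul hp, mul_mul_mul_comm, ← hH, coeff_one_sub_mul_one_sub_mul,
      inv_mul_cancel₀ hz]
    ring
  -- Scaling only the `z⁻¹` series by `q²` amounts to `r = q` and argument `q⁻¹ z`.
  · rw [← coeff_qBinomialSeries_mul (q ^ 2) β (mul_ne_zero (inv_ne_zero hq0) hz)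
      (show q ^ 2 * z⁻¹ = q * (q⁻¹ * z)⁻¹ by field_simp)
      (show z = q * (q⁻¹ * z) by field_simp) n, qBinomialSeries_mul hp,
      qBinomialSeries_eq hp β z, mul_mul_mul_comm, ← hH, coeff_one_sub_mul_one_sub_mul,
      mul_left_comm, inv_mul_cancel₀ hz]
    ring

/-- The right-hand side of the second identity of the theorem. -/
noncomputable def ultrasphericalTerm (l m : ℕ) (q z : ℂ) : ℂ :=
  qShifted q (q ^ 2) m / qShifted (q ^ (2 * (l - m) + 2)) (q ^ 2) m * z ^ (-(m : ℤ)) *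
    qShifted (q * z ^ 2) (q ^ 2) m * qUltraspherical (l - m) (q ^ (1 + 2 * m)) (q ^ 2) z

theorem ultrasphericalTerm_eq (hq : ∀ k, q ^ (k + 1) ≠ 1) (m n : ℕ) (z : ℂ) :
    ultrasphericalTerm (m + n) m q z = qShifted q (q ^ 2) m * qShifted (q ^ 2) (q ^ 2) n /
      qShifted (q ^ 2) (q ^ 2) (m + n) * (z ^ m)⁻¹ * qShifted (q * z ^ 2) (q ^ 2) m *
      qUltraspherical n (q * q ^ (2 * m)) (q ^ 2) z := by
  have h1 := qShifted_sq_ne_zero hq n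
  have h2 := qShifted_sq_ne_zero hq (m + n)
  have e := qShifted_add (q ^ 2) (q ^ 2) n m
  rw [add_comm n m, show q ^ 2 * (q ^ 2) ^ n = q ^ (2 * n + 2) by ring] at e
  rw [ultrasphericalTerm, Nat.add_sub_cancel_left, zpow_neg, zpow_natCast, pow_add q 1,
    pow_one]
  rw [e] at h2 ⊢
  have h3 := right_ne_zero_of_mul h2
  have e2 : qShifted q (q ^ 2) m * qShifted (q ^ 2) (q ^ 2) n /
      (qShifted (q ^ 2) (q ^ 2) n * qShifted (q ^ (2 * n + 2)) (q ^ 2) m) =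
      qShifted q (q ^ 2) m / qShifted (q ^ (2 * n + 2)) (q ^ 2) m := by
    field_simp
  rw [e2]

/-- Here `e` is the shifted polynomial times a power of `q`; `g`, `g'` and `G` are neighbours in
degree and parameter; `h` and `c` are the coefficients for the raised parameter. `E4` eliminates
`G`, then `E3`, `E1`, `E2` eliminate `g'`, `e`, `g`, and the remaining terms in `h` and `c` cancel.
-/
theorem ultraspherical_relation_algebra {M P e g g' G h c : ℂ} (hq0 : q ≠ 0) (hz : z ≠ 0)
    (hP : P ≠ 0) (h1 : 1 + M ≠ 0) (h2 : 1 + q * M ≠ 0) (h3 : q + M ≠ 0)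
    (E1 : e - g = -(1 - q * M) * z⁻¹ * h + q * M * (1 - q * M) * c)
    (E2 : (1 - P) * g = (1 - q * M) * (z + z⁻¹) * h - (1 - (q * M) ^ 2) * c)
    (E3 : (1 - M ^ 2 * P) * g' = (1 - (q * M) ^ 2) * h - q * M * (1 - q * M) * (z + z⁻¹) * c)
    (E4 : (1 - q ^ 2 * P) * G = (1 - M / q) * (z + z⁻¹) * g - (1 - (M / q) ^ 2) * g') :
    (1 - M / q) * (1 - P) * (1 - z ^ 2 / q) / P * e =
      (1 - 1 / P) / ((1 + M) * (1 + q * M)) * ((1 - M / q) * (1 - q * M) * z⁻¹ *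
        (1 - M / q * z ^ 2) * (1 - q * M * z ^ 2) * h) +
      (1 - (1 - 1 / P) / ((1 + M) * (1 + q * M)) -
        -(1 / P) * (1 - M ^ 2 * P) / ((q + M) * (1 + M))) *
        ((1 - M / q) * (1 - P) * (1 - M / q * z ^ 2) * g) +
      -(1 / P) * (1 - M ^ 2 * P) / ((q + M) * (1 + M)) * ((1 - P) * (1 - q ^ 2 * P) * z * G) := by
  have h4 : 1 + M * q ≠ 0 := by rwa [mul_comm]
  linear_combination (norm := skip)
    (1 - M / q) * (1 - P) * (1 - z ^ 2 / q) / P * E1 +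
    ((1 - M / q) * (1 - z ^ 2 / q) / P - (1 - (1 - 1 / P) / ((1 + M) * (1 + q * M)) -
        -(1 / P) * (1 - M ^ 2 * P) / ((q + M) * (1 + M))) * (1 - M / q) * (1 - M / q * z ^ 2) -
      -(1 / P) * (1 - M ^ 2 * P) / ((q + M) * (1 + M)) * z * (1 - M / q) * (z + z⁻¹)) * E2 -
    (-(1 / P) / ((q + M) * (1 + M)) * (1 - P) * z * (-(1 - (M / q) ^ 2))) * E3 -
    (-(1 / P) * (1 - M ^ 2 * P) / ((q + M) * (1 + M)) * (1 - P) * z) * E4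
  field_simp
  ring

theorem ultrasphericalTerm_initial (hq0 : q ≠ 0) (hq : ∀ k, q ^ (k + 1) ≠ 1) (hz : z ≠ 0) (n : ℕ) :
    (q ^ (n + 1))⁻¹ * ultrasphericalTerm (n + 1) 0 q (q⁻¹ * z) =
      2 * hahnUp (n + 1) q 0 * ultrasphericalTerm (n + 1) 1 q z +
        (1 - 2 * hahnUp (n + 1) q 0) * ultrasphericalTerm (n + 1) 0 q z := by
  have t0 : ∀ w, ultrasphericalTerm (n + 1) 0 q w = qUltraspherical (n + 1) q (q ^ 2) w := fun w => by
    simp [ultrasphericalTerm]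
  have t1 := ultrasphericalTerm_eq hq 1 n z
  rw [add_comm 1 n, mul_one, show q * q ^ 2 = q * (q ^ 2) by rfl] at t1
  obtain ⟨H, hH⟩ : ∃ H, H = qBinomialSeries (q ^ 2) (q * q ^ 2) z⁻¹ *
    qBinomialSeries (q ^ 2) (q * q ^ 2) z := ⟨_, rfl⟩
  obtain ⟨r1, r2, r3⟩ := qUltraspherical_relations hq0 hq hz q (n + 1) hH
  simp only [PowerSeries.coeff_succ_X_mul] at r1 r2 r3
  have hh := coeff_qBinomialSeries_mul (q ^ 2) (q * q ^ 2) hz (one_mul z⁻¹).symm (one_mul z).symm n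
  rw [one_pow, one_mul, ← hH] at hh
  rw [hh] at r1 r2 r3
  have e1 : qUltraspherical (n + 1) q (q ^ 2) (q⁻¹ * z) = (q ^ (n + 1))⁻¹ *
      (q ^ (n + 1) * qUltraspherical (n + 1) q (q ^ 2) (q⁻¹ * z)) := by
    rw [inv_mul_cancel_left₀ (pow_ne_zero _ hq0)]
  rw [t0, t0, t1, e1, hahnUp]
  simp only [qShifted_succ, qShifted_zero, mul_zero, pow_zero, zero_add, pow_one, one_mul, mul_one]
  have k1 : 1 + q ≠ 0 := by simpa using neg_pow_ne_one hq 1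
  have k2 := qShifted_sq_ne_zero hq n
  have k3 : 1 - q ^ 2 * (q ^ 2) ^ n ≠ 0 := by
    rw [← pow_succ']; exact one_sub_pow_ne_zero (sq_pow_ne_one hq) n
  have k4 := pow_ne_zero (n + 1) hq0
  rw [show q ^ (2 * (n + 1)) = q ^ (n + 1) * q ^ (n + 1) by ring]
  rw [show q ^ 2 * (q ^ 2) ^ n = q ^ (n + 1) * q ^ (n + 1) by ring] at *
  rw [show (q ^ 2) ^ (n + 1) = q ^ (n + 1) * q ^ (n + 1) by ring] at r2
  generalize q ^ (n + 1) * qUltraspherical (n + 1) q (q ^ 2) (q⁻¹ * z) = e at *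
  generalize qUltraspherical (n + 1) q (q ^ 2) z = g at *
  generalize qUltraspherical n (q * q ^ 2) (q ^ 2) z = h at *
  generalize qShifted (q ^ 2) (q ^ 2) n = S at *
  generalize q ^ (n + 1) = Q at *
  generalize PowerSeries.coeff n (PowerSeries.X * H) = c at *
  generalize PowerSeries.coeff (n + 1) H = d at *
  -- The combination `(1 + q) r3 - r1 - q r2` is the one that cancels both `c` and `d`.
  have star : (1 + q) * e = (1 + q * (Q * Q)) * g - (1 - q) * z⁻¹ * (1 - q * z ^ 2) * h := by
    have hzz : z⁻¹ * z = 1 := inv_mul_cancel₀ hz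
    linear_combination (1 + q) * r3 - r1 - q * r2 - (1 - q) * q * z * h * hzz
  have e' : e = ((1 + q * (Q * Q)) * g - (1 - q) * z⁻¹ * (1 - q * z ^ 2) * h) / (1 + q) := by
    rw [← star, mul_div_cancel_left₀ _ k1]
  rw [e']
  have k5 : 1 - Q ^ 2 ≠ 0 := by rwa [pow_two]
  have e2 : (1 - q) * S / (S * (1 - Q * Q)) = (1 - q) / (1 - Q * Q) := by field_simp
  rw [e2]
  field_simp
  ring

theorem ultrasphericalTerm_recurrence (hq0 : q ≠ 0) (hq : ∀ k, q ^ (k + 1) ≠ 1) (hz : z ≠ 0)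
    {l n : ℕ} (hn : n + 2 ≤ l) :
    (q ^ l)⁻¹ * ultrasphericalTerm l (n + 1) q (q⁻¹ * z) =
      hahnUp l q (n + 1) * ultrasphericalTerm l (n + 2) q z +
        (1 - hahnUp l q (n + 1) - hahnDown l q (n + 1)) * ultrasphericalTerm l (n + 1) q z +
        hahnDown l q (n + 1) * ultrasphericalTerm l n q z := by
  obtain ⟨ν, rfl⟩ : ∃ ν, l = n + ν + 2 := ⟨l - (n + 2), by omega⟩
  have t1 := fun w => ultrasphericalTerm_eq hq (n + 1) (ν + 1) w
  have t2 := ultrasphericalTerm_eq hq (n + 2) ν z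
  have t0 := ultrasphericalTerm_eq hq n (ν + 2) z
  rw [show n + 2 + ν = n + ν + 2 by ring] at t2
  rw [show n + (ν + 2) = n + ν + 2 by ring] at t0
  simp only [show n + 1 + (ν + 1) = n + ν + 2 by ring] at t1
  have b1 : q * q ^ (2 * (n + 2)) = q * q ^ (2 * (n + 1)) * q ^ 2 := by ring
  have b2 : q * q ^ (2 * (n + 1)) = q * q ^ (2 * n) * q ^ 2 := by ring
  rw [t1, t1, t2, t0, b1]
  obtain ⟨H, hH⟩ : ∃ H, H = qBinomialSeries (q ^ 2) (q * q ^ (2 * (n + 1)) * q ^ 2) z⁻¹ *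
    qBinomialSeries (q ^ 2) (q * q ^ (2 * (n + 1)) * q ^ 2) z := ⟨_, rfl⟩
  obtain ⟨r1, r2, r3⟩ := qUltraspherical_relations hq0 hq hz (q * q ^ (2 * (n + 1))) (ν + 1) hH
  obtain ⟨s1, s2, -⟩ := qUltraspherical_relations hq0 hq hz (q * q ^ (2 * (n + 1))) ν hH
  obtain ⟨u1, u2, -⟩ := qUltraspherical_relations hq0 hq hz (q * q ^ (2 * n)) (ν + 2) rfl
  simp only [PowerSeries.coeff_succ_X_mul] at r1 r2 r3 u1 u2
  have hh : ∀ β n, PowerSeries.coeff n (qBinomialSeries (q ^ 2) β z⁻¹ *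
      qBinomialSeries (q ^ 2) β z) = qUltraspherical n β (q ^ 2) z := fun β n => by
    have := coeff_qBinomialSeries_mul (q ^ 2) β hz (one_mul z⁻¹).symm (one_mul z).symm n
    rwa [one_pow, one_mul] at this
  rw [show PowerSeries.coeff ν H = _ from hH ▸ hh _ ν] at r1 r2 r3 s1 s2
  rw [hh _ (ν + 1), hh _ ν, ← b2] at u1 u2
  have e1 : qUltraspherical (ν + 1) (q * q ^ (2 * (n + 1))) (q ^ 2) (q⁻¹ * z) = (q ^ (ν + 1))⁻¹ *
      (q ^ (ν + 1) * qUltraspherical (ν + 1) (q * q ^ (2 * (n + 1))) (q ^ 2) (q⁻¹ * z)) := by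
    rw [inv_mul_cancel_left₀ (pow_ne_zero _ hq0)]
  have e2 : qShifted (q * (q⁻¹ * z) ^ 2) (q ^ 2) (n + 1) =
      (1 - z ^ 2 / q) * qShifted (q * z ^ 2) (q ^ 2) n := by
    rw [qShifted_succ', show q * (q⁻¹ * z) ^ 2 = z ^ 2 / q by field_simp,
      show z ^ 2 / q * q ^ 2 = q * z ^ 2 by field_simp]
  rw [e1, e2]
  generalize q ^ (ν + 1) * qUltraspherical (ν + 1) (q * q ^ (2 * (n + 1))) (q ^ 2) (q⁻¹ * z) = e at *
  generalize qUltraspherical (ν + 1) (q * q ^ (2 * (n + 1))) (q ^ 2) z = g at *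
  generalize qUltraspherical ν (q * q ^ (2 * (n + 1))) (q ^ 2) z = g' at *
  generalize qUltraspherical (ν + 2) (q * q ^ (2 * n)) (q ^ 2) z = G at *
  generalize qUltraspherical ν (q * q ^ (2 * (n + 1)) * q ^ 2) (q ^ 2) z = h at *
  generalize PowerSeries.coeff ν (PowerSeries.X * H) = c at *
  have h1 := neg_pow_ne_one hq (2 * (n + 1))
  have h2 : 1 + q * q ^ (2 * (n + 1)) ≠ 0 := by rw [← pow_succ']; exact neg_pow_ne_one hq _
  have h3 : q + q ^ (2 * (n + 1)) ≠ 0 := by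
    have := mul_ne_zero hq0 (neg_pow_ne_one hq (2 * n + 1))
    intro e; apply this; rw [← e]; ring
  have f1 : q ^ (2 * n) = q ^ (2 * (n + 1)) / q ^ 2 := by
    rw [eq_div_iff (pow_ne_zero 2 hq0)]; ring
  have hP := pow_ne_zero (2 * (ν + 1)) hq0
  have main := ultraspherical_relation_algebra (M := q ^ (2 * (n + 1))) (P := q ^ (2 * (ν + 1)))
    (e := e) (g := g) (g' := g') (G := G) (h := h) (c := c) hq0 hz hP h1 h2 h3
    (by
      linear_combination r3 - r1)
    (by
      have : q ^ (2 * (ν + 1)) = (q ^ 2) ^ (ν + 1) := by ring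
      rw [this]
      linear_combination r1 - r2)
    (by
      have : (q ^ (2 * (n + 1))) ^ 2 * q ^ (2 * (ν + 1)) =
        (q * q ^ (2 * (n + 1))) ^ 2 * (q ^ 2) ^ ν := by ring
      rw [this]
      linear_combination s1 - (q * q ^ (2 * (n + 1))) ^ 2 * s2)
    (by
      have : q ^ 2 * q ^ (2 * (ν + 1)) = (q ^ 2) ^ (ν + 2) := by ring
      have f2 : q ^ (2 * (n + 1)) / q = q * q ^ (2 * n) := by rw [f1]; field_simp
      rw [this, f2]
      linear_combination u1 - u2)
  unfold hahnUp hahnDown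
  rw [qShifted_succ q _ (n + 1), qShifted_succ q _ n, qShifted_succ (q * z ^ 2) _ (n + 1),
    qShifted_succ (q * z ^ 2) _ n, qShifted_succ (q ^ 2) _ (ν + 1), qShifted_succ (q ^ 2) _ ν]
  have hqn := pow_ne_zero (2 * (n + 1)) hq0
  have m1 : q ^ (2 * (n + 1)) / q ^ (2 * (n + ν + 2)) = 1 / q ^ (2 * (ν + 1)) := by
    rw [show 2 * (n + ν + 2) = 2 * (n + 1) + 2 * (ν + 1) by ring, pow_add]
    field_simp
  have m2 : q ^ (2 * (n + 1)) * q ^ (2 * (n + ν + 2)) =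
      (q ^ (2 * (n + 1))) ^ 2 * q ^ (2 * (ν + 1)) := by ring
  have m3 : q * (q ^ 2) ^ n = q ^ (2 * (n + 1)) / q := by field_simp; ring
  have m4 : q * (q ^ 2) ^ (n + 1) = q * q ^ (2 * (n + 1)) := by ring
  have m5 : q * z ^ 2 * (q ^ 2) ^ n = q ^ (2 * (n + 1)) / q * z ^ 2 := by rw [← m3]; ring
  have m6 : q * z ^ 2 * (q ^ 2) ^ (n + 1) = q * q ^ (2 * (n + 1)) * z ^ 2 := by ring
  have m7 : q ^ 2 * (q ^ 2) ^ ν = q ^ (2 * (ν + 1)) := by ring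
  have m8 : q ^ 2 * (q ^ 2) ^ (ν + 1) = q ^ 2 * q ^ (2 * (ν + 1)) := by ring
  -- The powers of `q` come from `q^{-l}`, from `z^{-(n+1)}` at `q⁻¹ z`, and from the normalisation
  -- of `e`.
  have m9 : (q ^ (n + ν + 2))⁻¹ * ((q⁻¹ * z) ^ (n + 1))⁻¹ * (q ^ (ν + 1))⁻¹ =
      (z ^ (n + 1))⁻¹ / q ^ (2 * (ν + 1)) := by
    rw [show 2 * (ν + 1) = (ν + 1) + (ν + 1) by ring, show n + ν + 2 = (ν + 1) + (n + 1) by ring,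
      pow_add q (ν + 1) (n + 1), pow_add q (ν + 1) (ν + 1), mul_pow, inv_pow]
    have := pow_ne_zero (n + 1) hq0
    have := pow_ne_zero (ν + 1) hq0
    generalize q ^ (n + 1) = x at *
    generalize q ^ (ν + 1) = y at *
    generalize z ^ (n + 1) = w at *
    field_simp
  have m10 : (z ^ (n + 2))⁻¹ = (z ^ (n + 1))⁻¹ * z⁻¹ := by rw [pow_succ _ (n + 1), mul_inv]
  have m11 : (z ^ n)⁻¹ = (z ^ (n + 1))⁻¹ * z := by rw [pow_succ]; field_simp
  rw [pow_succ' q (2 * (n + 1)), m1, m2, m3, m4, m5, m6, m7, m8, m10, m11]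
  linear_combination (qShifted q (q ^ 2) n * qShifted (q ^ 2) (q ^ 2) ν /
    qShifted (q ^ 2) (q ^ 2) (n + ν + 2) * (z ^ (n + 1))⁻¹ * qShifted (q * z ^ 2) (q ^ 2) n) * main +
    (qShifted q (q ^ 2) n * (1 - q ^ (2 * (n + 1)) / q) * (qShifted (q ^ 2) (q ^ 2) ν *
    (1 - q ^ (2 * (ν + 1)))) / qShifted (q ^ 2) (q ^ 2) (n + ν + 2) * ((1 - z ^ 2 / q) *
    qShifted (q * z ^ 2) (q ^ 2) n) * e) * m9

end

-- Specialisation to the stated parameters and conclusion.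

attribute [local irreducible] qShifted

/-- The denominators do not vanish: `ab = q^{m+1}` has all its products with powers of `q` below
`1`, and `ac`, `ad` are negative. -/
theorem qJacobi_eq_awPoly {q h t : ℝ} (hq0 : 0 < q) (hq1 : q < 1) (hh : h = q ^ (1 / 2 : ℝ))
    (ht : 0 < t) (n m : ℕ) (z : ℂ) :
    qJacobi n m m 1 t q z = awPoly n ((h : ℂ) * t) (h * (q : ℂ) ^ m / t) (-(h / t))
      (-(h * t * (q : ℂ) ^ m)) q z := by
  have hh2 : h * h = q := by rw [hh, ← Real.rpow_add hq0]; norm_num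
  have hh0 : 0 < h := by rw [hh]; exact Real.rpow_pos_of_pos hq0 _
  have e1 : q ^ (1 / 2 + m : ℝ) = h * q ^ m := by
    rw [Real.rpow_add hq0, ← hh, Real.rpow_natCast]
  have c1 : ((q ^ (1 / 2 : ℝ) * t / 1 : ℝ) : ℂ) = (h : ℂ) * t := by rw [← hh]; push_cast; ring
  have c2 : ((q ^ (1 / 2 + m : ℝ) * 1 / t : ℝ) : ℂ) = h * (q : ℂ) ^ m / t := by
    rw [e1]; push_cast; ring
  have c3 : ((-(q ^ (1 / 2 : ℝ) / (1 * t)) : ℝ) : ℂ) = -(h / t) := by rw [← hh]; push_cast; ring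
  have c4 : ((-(1 * t * q ^ (1 / 2 + m : ℝ)) : ℝ) : ℂ) = -(h * t * (q : ℂ) ^ m) := by
    rw [e1]; push_cast; ring
  rw [qJacobi, c1, c2, c3, c4]
  have ht' := ht.ne'
  refine askeyWilson_eq_awPoly (by exact_mod_cast hq0.ne') (fun i e => ?_) (fun i e => ?_)
    (fun i e => ?_)
  · have e' : h * t * (h * q ^ m / t) * q ^ i = 1 := by exact_mod_cast e
    have : q ^ (m + i + 1) = 1 := by
      rw [← e', pow_succ, pow_add, ← hh2]; field_simp
    exact (pow_lt_one₀ hq0.le hq1 (Nat.succ_ne_zero _)).ne this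
  · have e' : h * t * (-(h / t)) * q ^ i = 1 := by exact_mod_cast e
    have : h * t * (-(h / t)) * q ^ i = -(q * q ^ i) := by rw [← hh2]; field_simp
    have h2 : 0 < q * q ^ i := by positivity
    linarith
  · have e' : h * t * (-(h * t * q ^ m)) * q ^ i = 1 := by exact_mod_cast e
    have h2 : 0 < h * t * (h * t * q ^ m) * q ^ i := by positivity
    linarith

/-- At `m = 0` the parameters are `±ht, ±h/t`, which `t ↦ t⁻¹` merely permutes. -/
theorem jacobiSummand_zero_inv {q h t z : ℂ} (hq0 : q ≠ 0) (hq : ∀ k, q ^ (k + 1) ≠ 1)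
    (hh0 : h ≠ 0) (ht : t ≠ 0) (hz : z ≠ 0) (l : ℕ) :
    jacobiSummand l 0 h t⁻¹ q z = jacobiSummand l 0 h t q z := by
  have h1 : h * t ≠ 0 := mul_ne_zero hh0 ht
  have h2 : h / t ≠ 0 := div_ne_zero hh0 ht
  simp only [jacobiSummand, pow_zero, mul_one, ← div_eq_mul_inv, div_inv_eq_mul, qShifted_zero,
    Nat.sub_zero]
  rw [awPoly_swap_middle _ (h / t), awPoly_swap_first hq0 hq h2 (neg_ne_zero.2 h1) h1
    (neg_ne_zero.2 h2) hz, awPoly_swap_middle, awPoly_swap_right]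
theorem proposition10p4 (q : ℝ) (hq0 : 0 < q) (hq1 : q < 1) (l m : ℕ) (hml : m ≤ l) :
    (∀ (τ : ℝ) (z : ℂ), z ≠ 0 →
      (aeval (((q : ℂ) ^ (-(l : ℤ))) • qShiftOp (q : ℂ))
          (qHahn m (q : ℂ)⁻¹ (q : ℂ)⁻¹ l ((q : ℂ) ^ 2)))
        (fun w : ℂ => qJacobi l 0 0 1 (q ^ (τ / 2)) q w) z =
      1 / 2 * qShifted ((q : ℂ) ^ (l + 1)) (q : ℂ) m * z ^ (-(m : ℤ)) *
        (qShifted (z * ((q ^ ((1 - τ) / 2) : ℝ) : ℂ)) (q : ℂ) m *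
            qShifted (-(z * ((q ^ ((1 + τ) / 2) : ℝ) : ℂ))) (q : ℂ) m *
            qJacobi (l - m) m m 1 (q ^ (τ / 2)) q z +
          qShifted (z * ((q ^ ((1 + τ) / 2) : ℝ) : ℂ)) (q : ℂ) m *
            qShifted (-(z * ((q ^ ((1 - τ) / 2) : ℝ) : ℂ))) (q : ℂ) m *
            qJacobi (l - m) m m 1 (q ^ (-τ / 2)) q z)) ∧
    (∀ z : ℂ, z ≠ 0 →
      (aeval (((q : ℂ) ^ (-(l : ℤ))) • qShiftOp (q : ℂ))
          (qHahn m (q : ℂ)⁻¹ (q : ℂ)⁻¹ l ((q : ℂ) ^ 2)))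
        (fun w : ℂ => qUltraspherical l (q : ℂ) ((q : ℂ) ^ 2) w) z =
      qShifted (q : ℂ) ((q : ℂ) ^ 2) m /
          qShifted ((q : ℂ) ^ (2 * (l - m) + 2)) ((q : ℂ) ^ 2) m *
        z ^ (-(m : ℤ)) * qShifted ((q : ℂ) * z ^ 2) ((q : ℂ) ^ 2) m *
        qUltraspherical (l - m) ((q : ℂ) ^ (1 + 2 * m)) ((q : ℂ) ^ 2) z) := by
  have hqc : (q : ℂ) ≠ 0 := by exact_mod_cast hq0.ne'
  have hq : ∀ k, (q : ℂ) ^ (k + 1) ≠ 1 := fun k e =>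
    (pow_lt_one₀ hq0.le hq1 (Nat.succ_ne_zero k)).ne (by exact_mod_cast e)
  refine ⟨fun τ z hz => ?_, fun z hz => ?_⟩
  · obtain ⟨h, hh⟩ : ∃ h, h = q ^ (1 / 2 : ℝ) := ⟨_, rfl⟩
    obtain ⟨t, ht⟩ : ∃ t, t = q ^ (τ / 2) := ⟨_, rfl⟩
    have ht0 : 0 < t := by rw [ht]; exact Real.rpow_pos_of_pos hq0 _
    have htc : (t : ℂ) ≠ 0 := by exact_mod_cast ht0.ne'
    have hh2 : (h : ℂ) ^ 2 = q := by
      have : h ^ 2 = q := by rw [hh, ← Real.rpow_natCast, ← Real.rpow_mul hq0.le]; norm_num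
      exact_mod_cast this
    have hhc : (h : ℂ) ≠ 0 := by rintro e; rw [e] at hh2; exact hqc (by rw [← hh2]; ring)
    have e1 : q ^ (-τ / 2) = t⁻¹ := by rw [ht, ← Real.rpow_neg hq0.le]; congr 1; ring
    have e2 : ((q ^ ((1 - τ) / 2) : ℝ) : ℂ) = h / t := by
      rw [show (1 - τ) / 2 = 1 / 2 - τ / 2 by ring, Real.rpow_sub hq0, ← hh, ← ht]; push_cast; rfl
    have e3 : ((q ^ ((1 + τ) / 2) : ℝ) : ℂ) = h * t := by
      rw [show (1 + τ) / 2 = 1 / 2 + τ / 2 by ring, Real.rpow_add hq0, ← hh, ← ht]; push_cast; rfl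
    have ht1 : (t : ℂ)⁻¹ ≠ 0 := inv_ne_zero htc
    have e4 : (fun w => qJacobi l 0 0 1 t q w) = jacobiSummand l 0 h t q := by
      funext w
      have := qJacobi_eq_awPoly hq0 hq1 hh ht0 l 0 w
      rw [Nat.cast_zero] at this
      rw [this, jacobiSummand]
      simp
    -- `F 0` has to be the given function on all of `ℂ`, whereas its equality with the mean of the
    -- two summands is available only for `w ≠ 0`; hence the separate case `n = 0`.
    obtain ⟨F, hF⟩ : ∃ F : ℕ → ℂ → ℂ, F = fun n => if n = 0 then jacobiSummand l 0 h t q else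
      fun w => (jacobiSummand l n h t q w + jacobiSummand l n h (t : ℂ)⁻¹ q w) / 2 := ⟨_, rfl⟩
    have hF0 : F 0 = jacobiSummand l 0 h t q := by simp only [hF, if_true]
    have hFn : ∀ n w, w ≠ 0 →
        F n w = (jacobiSummand l n h t q w + jacobiSummand l n h (t : ℂ)⁻¹ q w) / 2 := by
      intro n w hw
      rcases Nat.eq_zero_or_pos n with rfl | hn
      · rw [hF0, jacobiSummand_zero_inv hqc hq hhc htc hw]; ring
      · simp only [hF, if_neg hn.ne']
    have key := aeval_qHahn_apply hqc hq l F
      (fun hl w hw => by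
        obtain ⟨n, rfl⟩ := Nat.exists_eq_add_of_le' hl
        rw [hF0, jacobiSummand_initial hqc hq hh2 htc hw, hFn 1 w hw]
        ring)
      (fun n hn w hw => by
        rw [hFn _ _ (mul_ne_zero (inv_ne_zero hqc) hw), hFn _ _ hw, hFn _ _ hw, hFn _ _ hw]
        linear_combination (1 / 2) * jacobiSummand_recurrence hqc hq hh2 htc hw hn +
          (1 / 2) * jacobiSummand_recurrence hqc hq hh2 ht1 hw hn) hml z hz
    have e5 := qJacobi_eq_awPoly hq0 hq1 hh ht0 (l - m) m z
    have e6 := qJacobi_eq_awPoly hq0 hq1 hh (inv_pos.2 ht0) (l - m) m z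
    rw [Complex.ofReal_inv] at e6
    rw [← ht, e1, e2, e3, e4, e5, e6, ← hF0, key, hFn m z hz, jacobiSummand, jacobiSummand,
      div_inv_eq_mul (h : ℂ), ← div_eq_mul_inv (h : ℂ), zpow_neg, zpow_natCast]
    ring
  · have key := aeval_qHahn_apply hqc hq l (fun m => ultrasphericalTerm l m q)
      (fun hl w hw => by
        obtain ⟨n, rfl⟩ := Nat.exists_eq_add_of_le' hl
        exact ultrasphericalTerm_initial hqc hq hw n)
      (fun n hn w hw => ultrasphericalTerm_recurrence hqc hq hw hn) hml z hz
    have e0 : (fun w => qUltraspherical l (q : ℂ) ((q : ℂ) ^ 2) w) =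
        ultrasphericalTerm l 0 q := by
      funext w
      simp [ultrasphericalTerm]
    rw [e0]
    exact key
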